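/- Let $k$ be a field, let $n\ge 1$, and let $\Delta_n$ be the cyclic quiver with vertices $1,\dots,n$ and arrows $x_i\colon i\to i+1$ (indices modulo $n$). Let $A$ be a Nakayama algebra of order $n$ over $k$, i.e. $A\cong k\Delta_n/(\mathcal R)$, where $\mathcal R$ is a nonempty finite set of paths of length $\ge 1$ (arrows are allowed in $\mathcal R$; since $\mathcal R\neq\emptyset$, $A$ is finite dimensional). Paths are composed from left to right and modules are right modules. Let $e_a$ be the idempotent and $S_a$ the simple module at $a$, let $\mathrm{id}\,S_a$ be the injective dimension of $S_a$, and let $p_a=\dim_k e_aA$. Put $\tau(a)=a+1$ (modulo $n$) and $\gamma(a)=\tau^{p_a}(a)$. The resolution quiver $R_A$ has vertices $1,\dots,n$ and one arrow $a\to\gamma(a)$ for each $a$; a vertex is cyclic if it lies on a cycle of $R_A$. Let $\mathbf d$ be a positive grading of $A$: every arrow $x_i$ has an integer degree $\mathbf d(x_i)>0$. Let $A_\ell$ be the degree $\ell$ part of $A$, and let $C(t)$ be the graded Cartan matrix, whose entries are $c_{ab}(t)=\sum_{\ell}\dim_k(e_bA_\ell e_a)\,t^\ell\in\mathbb Z[t^{\pm1}]$.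 Then there is exactly one weighting on $C(t)$ over $\mathbb Q(t)$, i.e. exactly one column vector $\alpha(t)=(\alpha_a(t))_a$ over $\mathbb Q(t)$ such that all entries of $C(t)\alpha(t)$ equal $1$. No $\alpha_a(t)$ has a pole at $t=1$, and for all vertices $a,b$: 1. if $\mathrm{id}\,S_a$ is odd, then $\alpha_a(1)=0$; 2. if $\mathrm{id}\,S_a$ is even, then $\alpha_a(1)=1$; 3. if $\mathrm{id}\,S_a$ is infinite, then $0<\alpha_a(1)<1$; 4. if $a$ is not cyclic, then $\alpha_a(1)=0$; 5. if $a$ and $b$ lie on the same cycle of $R_A$, then $\alpha_a(1)=\alpha_b(1)$. -/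

import Mathlib

universe u v

/-- A path in the cyclic quiver `Δ_n` with vertices `ZMod n` and one arrow `x_i : i → i + 1` for
every vertex `i`. Such a path is determined by its starting vertex and its length. -/
@[ext]
structure CyclicPath (n : ℕ) where
  /-- the starting vertex -/
  src : ZMod n
  /-- the number of arrows -/
  length : ℕ

namespace CyclicPath

/-- The vertex where a path ends. -/
def tgt {n : ℕ} (p : CyclicPath n) : ZMod n := p.src + p.length

/-- The trivial path at a vertex. -/
def triv {n : ℕ} (a : ZMod n) : CyclicPath n := ⟨a, 0⟩

/-- The arrow `x_a : a → a + 1`, as a path. -/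
def arrow {n : ℕ} (a : ZMod n) : CyclicPath n := ⟨a, 1⟩

/-- The concatenation of two paths: first `p`, then `q` (meaningful if `q` starts where `p`
ends). -/
def comp {n : ℕ} (p q : CyclicPath n) : CyclicPath n := ⟨p.src, p.length + q.length⟩

/-- The degree of a path for a grading `d` of the arrows: the sum of the degrees of its arrows. -/
def degree {n : ℕ} (d : ZMod n → ℤ) (p : CyclicPath n) : ℤ :=
  ∑ i ∈ Finset.range p.length, d (p.src + i)

end CyclicPath

/-- The path algebra `k Δ_n`: the vector space with basis the paths of `Δ_n`. -/
def CyclicPathAlgebra (k : Type u) [Field k] (n : ℕ) : Type u := CyclicPath n →₀ k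

namespace CyclicPathAlgebra

variable (k : Type u) [Field k] (n : ℕ)

noncomputable instance : AddCommGroup (CyclicPathAlgebra k n) :=
  inferInstanceAs (AddCommGroup (CyclicPath n →₀ k))

noncomputable instance : Module k (CyclicPathAlgebra k n) :=
  inferInstanceAs (Module k (CyclicPath n →₀ k))

variable {n}

/-- The basis vector of the path algebra given by a path. -/
noncomputable def ofPath (p : CyclicPath n) : CyclicPathAlgebra k n :=
  (Finsupp.single p 1 : CyclicPath n →₀ k)

/-- The product of two paths, first `p`, then `q`: their concatenation if `q` starts where `p`
ends, and zero otherwise. -/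
noncomputable def pathMul (p q : CyclicPath n) : CyclicPathAlgebra k n :=
  if q.src = p.tgt then ofPath k (p.comp q) else 0

variable (n)

/-- The bilinear extension of the product of paths. -/
noncomputable def mulLin :
    CyclicPathAlgebra k n →ₗ[k] CyclicPathAlgebra k n →ₗ[k] CyclicPathAlgebra k n :=
  Finsupp.linearCombination k
    (fun p => (Finsupp.linearCombination k (fun q => pathMul k p q) :
      CyclicPathAlgebra k n →ₗ[k] CyclicPathAlgebra k n))

noncomputable instance : Mul (CyclicPathAlgebra k n) := ⟨fun x y => mulLin k n x y⟩

variable {k n}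

theorem mul_def (x y : CyclicPathAlgebra k n) : x * y = mulLin k n x y := rfl

theorem ofPath_mul_ofPath (p q : CyclicPath n) :
    ofPath k p * ofPath k q = if q.src = p.tgt then ofPath k (p.comp q) else 0 := by
  rw [mul_def, mulLin, ofPath, ofPath]
  erw [Finsupp.linearCombination_single, one_smul, Finsupp.linearCombination_single, one_smul]
  rfl

theorem induction {P : CyclicPathAlgebra k n → Prop} (x : CyclicPathAlgebra k n)
    (h0 : P 0) (hadd : ∀ x y, P x → P y → P (x + y))
    (hsmul : ∀ (c : k) (p : CyclicPath n), P (c • ofPath k p)) : P x := by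
  refine Finsupp.induction_linear (motive := P) x h0 hadd ?_
  intro p c
  have h := hsmul c p
  have e : c • ofPath k p = (Finsupp.single p c : CyclicPath n →₀ k) := by
    change c • (Finsupp.single p 1 : CyclicPath n →₀ k) = _
    simp
  exact e ▸ h

theorem add_mul' (x y z : CyclicPathAlgebra k n) : (x + y) * z = x * z + y * z := by
  simp [mul_def]

theorem mul_add' (x y z : CyclicPathAlgebra k n) : x * (y + z) = x * y + x * z := by
  simp [mul_def]

theorem smul_mul' (c : k) (x y : CyclicPathAlgebra k n) : (c • x) * y = c • (x * y) := by
  simp [mul_def]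

theorem mul_smul' (c : k) (x y : CyclicPathAlgebra k n) : x * (c • y) = c • (x * y) := by
  simp [mul_def]

theorem zero_mul' (x : CyclicPathAlgebra k n) : 0 * x = 0 := by
  simp [mul_def]

theorem mul_zero' (x : CyclicPathAlgebra k n) : x * 0 = 0 := by
  simp [mul_def]

theorem ofPath_mul_assoc (p q r : CyclicPath n) :
    ofPath k p * ofPath k q * ofPath k r = ofPath k p * (ofPath k q * ofPath k r) := by
  rw [ofPath_mul_ofPath p q, ofPath_mul_ofPath q r]
  by_cases h1 : q.src = p.tgt <;> by_cases h2 : r.src = q.tgt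
  · have h3 : r.src = (p.comp q).tgt := by
      simp only [CyclicPath.tgt, CyclicPath.comp] at *
      rw [h2, h1]; push_cast; ring
    have h4 : (q.comp r).src = p.tgt := h1
    rw [if_pos h1, if_pos h2, ofPath_mul_ofPath, ofPath_mul_ofPath, if_pos h3, if_pos h4]
    congr 1
    ext
    · rfl
    · exact Nat.add_assoc _ _ _
  · have h3 : ¬ r.src = (p.comp q).tgt := by
      intro h
      apply h2
      simp only [CyclicPath.tgt, CyclicPath.comp] at *
      rw [h, h1]; push_cast; ring
    rw [if_pos h1, if_neg h2, ofPath_mul_ofPath, if_neg h3, mul_zero']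
  · have h4 : ¬ (q.comp r).src = p.tgt := h1
    rw [if_neg h1, if_pos h2, ofPath_mul_ofPath, if_neg h4, zero_mul']
  · rw [if_neg h1, if_neg h2, zero_mul', mul_zero']

theorem mul_assoc' (x y z : CyclicPathAlgebra k n) : x * y * z = x * (y * z) := by
  refine induction (P := fun x => x * y * z = x * (y * z)) x ?_ ?_ ?_
  · simp only [zero_mul']
  · intro a b ha hb; simp only [add_mul', ha, hb]
  intro c p
  refine induction (P := fun y => c • ofPath k p * y * z = c • ofPath k p * (y * z)) y ?_ ?_ ?_
  · simp only [zero_mul', mul_zero']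
  · intro a b ha hb; simp only [add_mul', mul_add', ha, hb]
  intro c' q
  refine induction (P := fun z => c • ofPath k p * c' • ofPath k q * z
    = c • ofPath k p * (c' • ofPath k q * z)) z ?_ ?_ ?_
  · simp only [mul_zero']
  · intro a b ha hb; simp only [mul_add', ha, hb]
  intro c'' r
  simp only [smul_mul', mul_smul', ofPath_mul_assoc]

variable [NeZero n]

/-- The unit of the path algebra is the sum of all trivial paths. -/
noncomputable instance : One (CyclicPathAlgebra k n) :=
  ⟨∑ a : ZMod n, ofPath k (CyclicPath.triv a)⟩

theorem one_def : (1 : CyclicPathAlgebra k n) = ∑ a : ZMod n, ofPath k (CyclicPath.triv a) := rfl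

theorem one_mul' (x : CyclicPathAlgebra k n) : 1 * x = x := by
  refine induction (P := fun x => 1 * x = x) x (mul_zero' _) ?_ ?_
  · intro a b ha hb; simp only [mul_add', ha, hb]
  · intro c p
    rw [mul_smul']
    congr 1
    have h : (1 : CyclicPathAlgebra k n) * ofPath k p
        = ∑ a : ZMod n, ofPath k (CyclicPath.triv a) * ofPath k p := by
      simp only [one_def, mul_def, map_sum, LinearMap.sum_apply]
    rw [h, Finset.sum_eq_single p.src]
    · rw [ofPath_mul_ofPath, if_pos (by simp [CyclicPath.tgt, CyclicPath.triv])]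
      congr 1
      ext <;> simp [CyclicPath.comp, CyclicPath.triv]
    · intro a _ ha
      rw [ofPath_mul_ofPath, if_neg]
      simpa [CyclicPath.tgt, CyclicPath.triv] using ha.symm
    · simp

theorem mul_one' (x : CyclicPathAlgebra k n) : x * 1 = x := by
  refine induction (P := fun x => x * 1 = x) x (zero_mul' _) ?_ ?_
  · intro a b ha hb; simp only [add_mul', ha, hb]
  · intro c p
    rw [smul_mul']
    congr 1
    have h : ofPath k p * (1 : CyclicPathAlgebra k n)
        = ∑ a : ZMod n, ofPath k p * ofPath k (CyclicPath.triv a) := by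
      simp only [one_def, mul_def, map_sum]
    rw [h, Finset.sum_eq_single p.tgt]
    · rw [ofPath_mul_ofPath, if_pos (by simp [CyclicPath.triv])]
      congr 1
    · intro a _ ha
      rw [ofPath_mul_ofPath, if_neg]
      simpa [CyclicPath.triv] using ha
    · simp

noncomputable instance : Ring (CyclicPathAlgebra k n) :=
  { (inferInstance : AddCommGroup (CyclicPathAlgebra k n)),
    (inferInstance : Mul (CyclicPathAlgebra k n)),
    (inferInstance : One (CyclicPathAlgebra k n)) with
    left_distrib := mul_add'
    right_distrib := add_mul'
    zero_mul := zero_mul'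
    mul_zero := mul_zero'
    mul_assoc := mul_assoc'
    one_mul := one_mul'
    mul_one := mul_one' }

noncomputable instance : Algebra k (CyclicPathAlgebra k n) :=
  Algebra.ofModule smul_mul' mul_smul'

end CyclicPathAlgebra

/-- The structure of a Nakayama algebra of order `n` on a `k`-algebra `A`: a nonempty finite set
`R` of nontrivial paths of `Δ_n` and an isomorphism of `A` with the quotient of the path algebra
`k Δ_n` by the two-sided ideal generated by `R`. The isomorphism is recorded as the corresponding
surjective algebra homomorphism `k Δ_n → A` whose kernel is that ideal. (The quotient is finite
dimensional exactly because `R` is nonempty.) -/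
structure NakayamaPresentation (k : Type u) [Field k] (n : ℕ) [NeZero n]
    (A : Type v) [Ring A] [Algebra k A] where
  /-- the finite set of relations -/
  rels : Finset (CyclicPath n)
  rels_nonempty : rels.Nonempty
  /-- the relations are nontrivial paths -/
  rels_length_pos : ∀ r ∈ rels, 0 < r.length
  /-- the projection from the path algebra -/
  proj : CyclicPathAlgebra k n →ₐ[k] A
  proj_surjective : Function.Surjective proj
  ker_proj : TwoSidedIdeal.ker proj =
    TwoSidedIdeal.span (CyclicPathAlgebra.ofPath k '' (rels : Set (CyclicPath n)))

namespace NakayamaPresentation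

variable {k : Type u} [Field k] {n : ℕ} [NeZero n] {A : Type v} [Ring A] [Algebra k A]
  (N : NakayamaPresentation k n A)

/-- The element of `A` given by a path. -/
noncomputable def path (p : CyclicPath n) : A := N.proj (CyclicPathAlgebra.ofPath k p)

/-- The idempotent `e_a`. -/
noncomputable def idem (a : ZMod n) : A := N.path (CyclicPath.triv a)

/-- The (class of the) arrow `x_a`. -/
noncomputable def arr (a : ZMod n) : A := N.path (CyclicPath.arrow a)

/-- The underlying vector space of the projective right module `P_a = e_a A`. -/
noncomputable def projModule (a : ZMod n) : Submodule k A :=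
  LinearMap.range (LinearMap.mulLeft k (N.idem a))

/-- `p_a`, the dimension of `P_a`. -/
noncomputable def projDim (a : ZMod n) : ℕ := Module.finrank k (N.projModule a)

/-- The map `γ(a) = τ^{p_a}(a)`, where `τ(a) = a + 1`. The resolution quiver of `A` is the
functional graph of `γ`. -/
noncomputable def gamma (a : ZMod n) : ZMod n := (fun b : ZMod n => b + 1)^[N.projDim a] a

/-- A vertex is cyclic if it lies on a cycle of the resolution quiver. -/
def IsCyclicVertex (a : ZMod n) : Prop := ∃ m : ℕ, 0 < m ∧ N.gamma^[m] a = a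

/-- Two vertices lie on the same cycle of the resolution quiver. -/
def OnSameCycle (a b : ZMod n) : Prop := N.IsCyclicVertex a ∧ ∃ m : ℕ, N.gamma^[m] a = b

/-- The right ideal of `A` generated by all arrows and by the idempotents `e_b`, `b ≠ a`. Right
`A`-modules are modules over the opposite ring `Aᵐᵒᵖ`. -/
def simpleIdeal (a : ZMod n) : Submodule Aᵐᵒᵖ A :=
  Submodule.span Aᵐᵒᵖ (Set.range N.arr ∪ N.idem '' {b | b ≠ a})

/-- The simple right module `S_a`, as a quotient of the regular right module `A`: it is one
dimensional, `e_a` acts on it as the identity, and the other idempotents and all arrows act as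
zero. -/
abbrev Simple (a : ZMod n) : Type v := A ⧸ N.simpleIdeal a

/-- The injective dimension `id S_a` of the simple right module `S_a`. -/
noncomputable def simpleInjDim (a : ZMod n) : WithBot ℕ∞ :=
  CategoryTheory.injectiveDimension (ModuleCat.of Aᵐᵒᵖ (N.Simple a))

/-- The degree `ℓ` part `A_ℓ` of `A` for the grading that gives the arrow `x_i` degree `d i`. -/
noncomputable def degreePart (d : ZMod n → ℤ) (l : ℤ) : Submodule k A :=
  Submodule.span k (N.path '' {p | p.degree d = l})

/-- The subspace `e_b A_ℓ e_a`. -/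
noncomputable def peircePart (d : ZMod n → ℤ) (l : ℤ) (b a : ZMod n) : Submodule k A :=
  (N.degreePart d l).map (LinearMap.mulLeft k (N.idem b) ∘ₗ LinearMap.mulRight k (N.idem a))

/-- The graded Cartan matrix, with entries `c_{ab}(t) = ∑_ℓ dim_k (e_b A_ℓ e_a) t^ℓ` in the ring of
integral Laurent polynomials. (Only finitely many terms are nonzero, as `A` is finite
dimensional.) -/
noncomputable def gradedCartan (d : ZMod n → ℤ) :
    Matrix (ZMod n) (ZMod n) (LaurentPolynomial ℤ) :=
  Matrix.of fun a b => ∑ᶠ l : ℤ,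
    LaurentPolynomial.C (Module.finrank k (N.peircePart d l b a) : ℤ) * LaurentPolynomial.T l

end NakayamaPresentation

/-- The embedding of `ℤ[t, t⁻¹]` into the field `ℚ(t)`. -/
noncomputable def laurentToRatFunc : LaurentPolynomial ℤ →+* RatFunc ℚ :=
  LaurentPolynomial.eval₂ (Int.castRingHom (RatFunc ℚ)) (Units.mk0 RatFunc.X RatFunc.X_ne_zero)

/-- A weighting on a square matrix `C` is a column vector `α` such that `C α` is the vector all of
whose entries are `1`. -/
def IsWeighting {ι R : Type*} [Fintype ι] [CommRing R] (C : Matrix ι ι R) (α : ι → R) : Prop :=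
  C.mulVec α = fun _ => 1

/-- `f(1) = c`: the rational function `f` has no pole at `1` and takes the value `c` there. -/
def HasValueAtOne (f : RatFunc ℚ) (c : ℚ) : Prop :=
  f.denom.eval 1 ≠ 0 ∧ f.eval (RingHom.id ℚ) 1 = c

/-! Unroll the quiver to `ℤ`. With `p_a = height a`, put `G i = i + p_i`. Since `p_a ≤ 1 + p_{a+1}`,
`G` is monotone; it lifts `γ` and has a left adjoint `f` (`exists_galoisConnection_liftedShift`).
Uniserial modules are intervals `[b, a)` with `a ≤ G b`. A nonempty `[b, a)` has injective hull `[f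
a, a)` and cosyzygy `[f a, b)`. Thus the minimal injective resolution of `S_x = [x, x+1)` comes from
iterating `(b, a) ↦ (f a, b)`, and `id S_x` says when this first gives an empty interval
(`interval_hasInjectiveDimensionLT_iff`).

At `t = 0` the graded Cartan matrix is the identity, so it is invertible over `ℚ(t)` and the
weighting is unique. Its row `x` is a sum over `[f (x+1), x+1)`. Subtracting `t^{d(x-1)}` times row
`x - 1` from row `x` leaves a system along the resolution quiver, `α_x = 1 - t^{d(x-1)} + ∑_{γ b =
x} t^{e_b} α_b` with `e_b > 0` (`isWeighting_system`). Iterate it until the power of `γ` is a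
projection onto the cyclic vertices. If `x` is not cyclic, `α_x` is `1 - t` times a polynomial. If
`x` is cyclic, `(1 - t^E) α_x` is `1 - t` times a polynomial positive at `1`. So the values `v_x` at
`t = 1` exist, vanish off the cycles, are positive on them and are constant along each cycle
(`exists_value_of_system`).

At `t = 1`, row `x` reads `v_x + ∑_{f(x+1) ≤ i < x} v_i = 1`. By adjunction, the resolution ends at
an odd step only if `x` is outside the image of some `G^r`, so `x` is not cyclic. It ends at an even
step only if no vertex of `[f(x+1), x)` is cyclic, so `v_x = 1`. If it never ends, both `x` and some
vertex of `[f(x+1), x)` are cyclic, so `0 < v_x < 1`. -/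

/-! ### Normal forms: the paths containing no relation form a basis of `A`. -/

namespace CyclicPathAlgebra

variable {k : Type u} [Field k] {n : ℕ}

/-- Linear maps out of the path algebra that agree on paths are equal. -/
theorem linearMap_ext {M : Type*} [AddCommGroup M] [Module k M]
    {f g : CyclicPathAlgebra k n →ₗ[k] M} (h : ∀ p, f (ofPath k p) = g (ofPath k p)) : f = g := by
  ext x
  refine induction (P := fun x => f x = g x) x (by simp) ?_ ?_
  · intro x y hx hy; simp [hx, hy]
  · intro c p; simp [h]

/-- The linear map out of the path algebra with prescribed values on paths. -/
noncomputable def lift {M : Type*} [AddCommGroup M] [Module k M] (φ : CyclicPath n → M) :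
    CyclicPathAlgebra k n →ₗ[k] M :=
  Finsupp.linearCombination k φ

theorem lift_ofPath {M : Type*} [AddCommGroup M] [Module k M] (φ : CyclicPath n → M)
    (p : CyclicPath n) : lift φ (ofPath k p) = φ p := by
  change Finsupp.linearCombination k φ (Finsupp.single p 1) = φ p
  rw [Finsupp.linearCombination_single, one_smul]

end CyclicPathAlgebra

namespace NakayamaPresentation

variable {k : Type u} [Field k] {n : ℕ} [NeZero n] {A : Type v} [Ring A] [Algebra k A]
  (N : NakayamaPresentation k n A)

open CyclicPathAlgebra

/-- The path of length `l` starting at `a` contains a relation. -/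
def ContainsRel (a : ZMod n) (l : ℕ) : Prop :=
  ∃ r ∈ N.rels, ∃ j : ℕ, j + r.length ≤ l ∧ r.src = a + j

theorem exists_containsRel (a : ZMod n) : ∃ l, N.ContainsRel a l := by
  obtain ⟨r, hr⟩ := N.rels_nonempty
  exact ⟨(r.src - a).val + r.length, r, hr, (r.src - a).val, le_rfl, by simp⟩

open Classical in
/-- The least length of a path starting at `a` that contains a relation. -/
noncomputable def height (a : ZMod n) : ℕ := Nat.find (N.exists_containsRel a)

theorem containsRel_iff (a : ZMod n) (l : ℕ) : N.ContainsRel a l ↔ N.height a ≤ l := by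
  classical
  constructor
  · intro h
    exact Nat.find_min' _ h
  · intro h
    obtain ⟨r, hr, j, hj, e⟩ := Nat.find_spec (N.exists_containsRel a)
    exact ⟨r, hr, j, hj.trans h, e⟩

theorem height_pos (a : ZMod n) : 0 < N.height a := by
  by_contra h
  obtain ⟨r, hr, j, hj, e⟩ := (N.containsRel_iff a 0).2 (by omega)
  have := N.rels_length_pos r hr
  omega

/-- A relation inside a tail of a path lies inside the whole path. This inequality is what makes the
lift of `γ` to `ℤ` monotone. -/
theorem height_le_add (a : ZMod n) (m : ℕ) : N.height a ≤ m + N.height (a + m) := by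
  rw [← containsRel_iff]
  obtain ⟨r, hr, j, hj, e⟩ := (N.containsRel_iff (a + m) _).2 le_rfl
  exact ⟨r, hr, m + j, by omega, by rw [e]; push_cast; ring⟩

theorem path_mul_path (p q : CyclicPath n) :
    N.path p * N.path q = if q.src = p.tgt then N.path (p.comp q) else 0 := by
  rw [path, path, ← map_mul, ofPath_mul_ofPath]
  split_ifs with h
  · rfl
  · exact map_zero _

theorem path_eq_zero {p : CyclicPath n} (hp : N.height p.src ≤ p.length) : N.path p = 0 := by
  obtain ⟨r, hr, j, hj, e⟩ := (N.containsRel_iff _ _).2 hp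
  have hr0 : N.path r = 0 := by
    have : ofPath k r ∈ TwoSidedIdeal.ker N.proj := by
      rw [N.ker_proj]
      exact TwoSidedIdeal.subset_span ⟨r, hr, rfl⟩
    exact (TwoSidedIdeal.mem_ker _).1 this
  have : N.path p = N.path ⟨p.src, j⟩ * N.path r *
      N.path ⟨p.src + j + r.length, p.length - (j + r.length)⟩ := by
    rw [path_mul_path, if_pos (by simpa [CyclicPath.tgt] using e), path_mul_path, if_pos]
    · congr 1
      ext
      · rfl
      · simp only [CyclicPath.comp]; omega
    · simp only [CyclicPath.tgt, CyclicPath.comp]; push_cast; ring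
  rw [this, hr0]
  simp

open Classical in
/-- The linear map on the path algebra that forgets all paths that contain a relation. -/
noncomputable def reduce : CyclicPathAlgebra k n →ₗ[k] CyclicPathAlgebra k n :=
  lift fun p => if p.length < N.height p.src then ofPath k p else 0

open Classical in
theorem reduce_ofPath (p : CyclicPath n) :
    N.reduce (ofPath k p) = if p.length < N.height p.src then ofPath k p else 0 :=
  lift_ofPath _ _

/-- A path containing a relation still contains it after prolongation, so discarding such paths
before multiplying changes nothing. With the right-hand version, this makes the kernel of `reduce` a
two-sided ideal. -/
theorem reduce_mul_left (x y : CyclicPathAlgebra k n) :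
    N.reduce (N.reduce x * y) = N.reduce (x * y) := by
  have h : N.reduce ∘ₗ (LinearMap.mulRight k y) ∘ₗ N.reduce
      = N.reduce ∘ₗ (LinearMap.mulRight k y) := by
    apply linearMap_ext
    intro p
    have h2 : N.reduce ∘ₗ LinearMap.mulLeft k (N.reduce (ofPath k p)) =
        N.reduce ∘ₗ LinearMap.mulLeft k (ofPath k p) := by
      apply linearMap_ext
      intro q
      simp only [LinearMap.comp_apply, LinearMap.mulLeft_apply, reduce_ofPath]
      split_ifs with hp
      · rfl
      · rw [zero_mul, map_zero, ofPath_mul_ofPath]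
        split_ifs
        · rw [reduce_ofPath, if_neg]
          simp only [CyclicPath.comp]
          omega
        · simp
    simpa using congrArg (fun f => f y) h2
  simpa using congrArg (fun f => f x) h

theorem reduce_mul_right (x y : CyclicPathAlgebra k n) :
    N.reduce (x * N.reduce y) = N.reduce (x * y) := by
  have h : N.reduce ∘ₗ (LinearMap.mulLeft k x) ∘ₗ N.reduce
      = N.reduce ∘ₗ (LinearMap.mulLeft k x) := by
    apply linearMap_ext
    intro q
    have h2 : N.reduce ∘ₗ LinearMap.mulRight k (N.reduce (ofPath k q)) =
        N.reduce ∘ₗ LinearMap.mulRight k (ofPath k q) := by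
      apply linearMap_ext
      intro p
      simp only [LinearMap.comp_apply, LinearMap.mulRight_apply, N.reduce_ofPath q]
      split_ifs with hp
      · rfl
      · rw [mul_zero, map_zero, ofPath_mul_ofPath]
        split_ifs with hs
        · rw [reduce_ofPath, if_neg]
          have := N.height_le_add p.src p.length
          rw [show p.src + p.length = q.src from hs.symm] at this
          simp only [CyclicPath.comp]
          omega
        · simp
    simpa using congrArg (fun f => f x) h2
  simpa using congrArg (fun f => f y) h

/-- Hence `reduce` is well defined on `A`, and the relation-free paths stay independent there. -/
theorem reduce_eq_zero_of_proj {x : CyclicPathAlgebra k n} (hx : N.proj x = 0) :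
    N.reduce x = 0 := by
  have hx : x ∈ TwoSidedIdeal.ker N.proj := (TwoSidedIdeal.mem_ker _).2 hx
  rw [N.ker_proj] at hx
  refine TwoSidedIdeal.span_induction (p := fun x _ => N.reduce x = 0) ?_ ?_ ?_ ?_ ?_ ?_ hx
  · rintro _ ⟨r, hr, rfl⟩
    rw [reduce_ofPath, if_neg]
    rw [not_lt, ← containsRel_iff]
    exact ⟨r, hr, 0, by simp, by simp⟩
  · simp
  · intro x y _ _ hx hy; simp [hx, hy]
  · intro x _ hx; simp [hx]
  · intro a x _ hx; rw [← reduce_mul_right, hx]; simp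
  · intro b x _ hx; rw [← reduce_mul_left, hx]; simp

theorem exists_section : ∃ s : A →ₗ[k] CyclicPathAlgebra k n, ∀ a, N.proj (s a) = a := by
  obtain ⟨s, hs⟩ := LinearMap.exists_rightInverse_of_surjective N.proj.toLinearMap
    (LinearMap.range_eq_top.2 N.proj_surjective)
  exact ⟨s, fun a => congrArg (fun f => f a) hs⟩

open Classical in
/-- The coefficient of a path in an element of `A`, for the basis of `A` given by the paths that
contain no relation. -/
noncomputable def coeff (p : CyclicPath n) : A →ₗ[k] k :=
  (lift fun q => if q = p then 1 else 0) ∘ₗ N.reduce ∘ₗ N.exists_section.choose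

open Classical in
theorem coeff_path (p q : CyclicPath n) :
    N.coeff p (N.path q) = if q = p ∧ p.length < N.height p.src then 1 else 0 := by
  have h : N.reduce (N.exists_section.choose (N.path q)) = N.reduce (ofPath k q) := by
    rw [← sub_eq_zero, ← map_sub]
    apply reduce_eq_zero_of_proj
    rw [map_sub, N.exists_section.choose_spec, path, sub_self]
  rw [coeff, LinearMap.comp_apply, LinearMap.comp_apply, h, reduce_ofPath]
  split_ifs with h1 h2 h2
  · rw [lift_ofPath, if_pos h2.1]
  · rw [lift_ofPath, if_neg]
    rintro rfl
    exact h2 ⟨rfl, h1⟩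
  · exact absurd (h2.1 ▸ h2.2) h1
  · simp

/-- Linear maps out of `A` that agree on the paths containing no relation are equal. -/
theorem linearMap_ext {M : Type*} [AddCommGroup M] [Module k M] {f g : A →ₗ[k] M}
    (h : ∀ p : CyclicPath n, p.length < N.height p.src → f (N.path p) = g (N.path p)) :
    f = g := by
  have h2 : f ∘ₗ N.proj.toLinearMap = g ∘ₗ N.proj.toLinearMap := by
    apply CyclicPathAlgebra.linearMap_ext
    intro p
    by_cases hp : p.length < N.height p.src
    · exact h p hp
    · change f (N.path p) = g (N.path p)
      rw [N.path_eq_zero (by omega)]; simp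
  ext a
  obtain ⟨x, rfl⟩ := N.proj_surjective a
  exact congrArg (fun f => f x) h2

theorem span_range_path : Submodule.span k (Set.range N.path) = ⊤ := by
  rw [eq_top_iff]
  rintro a -
  obtain ⟨x, rfl⟩ := N.proj_surjective a
  refine CyclicPathAlgebra.induction
    (P := fun x => N.proj x ∈ Submodule.span k (Set.range N.path)) x (by simp) ?_ ?_
  · intro x y hx hy; rw [map_add]; exact add_mem hx hy
  · intro c p; rw [map_smul]; exact Submodule.smul_mem _ _ (Submodule.subset_span ⟨p, rfl⟩)

/-- The functionals `coeff p` are dual to the relation-free paths, which gives linear independence.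
-/
theorem finrank_span_path (S : Finset (CyclicPath n)) (hS : ∀ p ∈ S, p.length < N.height p.src) :
    Module.finrank k (Submodule.span k (N.path '' (S : Set (CyclicPath n)))) = S.card := by
  have hli : LinearIndependent k (fun p : S => N.path p) := by
    rw [Fintype.linearIndependent_iff]
    intro g hg p
    have := congrArg (N.coeff (p : CyclicPath n)) hg
    rw [map_sum, map_zero, Finset.sum_eq_single p] at this
    · simpa [coeff_path, hS _ p.2] using this
    · intro q _ hq
      rw [map_smul, coeff_path, if_neg, smul_zero]
      rintro ⟨h, -⟩
      exact hq (Subtype.ext h)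
    · simp
  have := finrank_span_eq_card hli
  rw [Fintype.card_coe] at this
  rw [← this]
  have e : N.path '' (S : Set (CyclicPath n)) = Set.range (fun p : S => N.path p) := by
    ext x; simp
  rw [e]

/-- The image of the span of some paths under a linear map that fixes or kills every path. -/
theorem finrank_map_span_path (f : A →ₗ[k] A) (T : Set (CyclicPath n)) (S : Finset (CyclicPath n))
    (P : CyclicPath n → Prop) (hf : ∀ p, P p → f (N.path p) = N.path p)
    (hf0 : ∀ p, ¬ P p → f (N.path p) = 0)
    (hS : ∀ p, p ∈ S ↔ p ∈ T ∧ P p ∧ p.length < N.height p.src) :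
    Module.finrank k ((Submodule.span k (N.path '' T)).map f) = S.card := by
  rw [← N.finrank_span_path S fun p hp => ((hS p).1 hp).2.2]
  suffices h : (Submodule.span k (N.path '' T)).map f
      = Submodule.span k (N.path '' (S : Set (CyclicPath n))) by rw [h]
  rw [Submodule.map_span]
  apply le_antisymm
  · rw [Submodule.span_le]
    rintro _ ⟨_, ⟨p, hp, rfl⟩, rfl⟩
    by_cases hP : P p
    · rw [hf p hP]
      by_cases hl : p.length < N.height p.src
      · exact Submodule.subset_span ⟨p, (hS p).2 ⟨hp, hP, hl⟩, rfl⟩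
      · rw [N.path_eq_zero (by omega)]; exact zero_mem _
    · rw [hf0 p hP]; exact zero_mem _
  · rw [Submodule.span_le]
    rintro _ ⟨p, hp, rfl⟩
    obtain ⟨h1, h2, -⟩ := (hS p).1 hp
    exact Submodule.subset_span ⟨N.path p, ⟨p, h1, rfl⟩, hf p h2⟩

theorem idem_mul_path (a : ZMod n) (p : CyclicPath n) :
    N.idem a * N.path p = if p.src = a then N.path p else 0 := by
  rw [idem, path_mul_path]
  simp only [CyclicPath.tgt, CyclicPath.triv, CyclicPath.comp, Nat.cast_zero, add_zero, zero_add]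
  split_ifs with h
  · congr 1
    ext
    · exact h.symm
    · rfl
  · rfl

theorem path_mul_idem (a : ZMod n) (p : CyclicPath n) :
    N.path p * N.idem a = if p.tgt = a then N.path p else 0 := by
  rw [idem, path_mul_path]
  simp only [CyclicPath.triv, CyclicPath.comp, add_zero, eq_comm]

theorem projDim_eq_height (a : ZMod n) : N.projDim a = N.height a := by
  classical
  rw [projDim, projModule, ← Submodule.map_top, ← N.span_range_path, ← Set.image_univ,
    N.finrank_map_span_path _ Set.univ ((Finset.range (N.height a)).image fun j => ⟨a, j⟩)
      (fun p => p.src = a), Finset.card_image_of_injective, Finset.card_range]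
  · intro i j h
    exact congrArg CyclicPath.length h
  · intro p hp
    rw [LinearMap.mulLeft_apply, idem_mul_path, if_pos hp]
  · intro p hp
    rw [LinearMap.mulLeft_apply, idem_mul_path, if_neg hp]
  · intro p
    simp only [Finset.mem_image, Finset.mem_range, Set.mem_univ, true_and]
    constructor
    · rintro ⟨j, hj, rfl⟩; exact ⟨rfl, hj⟩
    · rintro ⟨rfl, h⟩; exact ⟨p.length, h, rfl⟩

theorem gamma_eq (a : ZMod n) : N.gamma a = a + N.height a := by
  rw [gamma, projDim_eq_height]
  generalize N.height a = m
  induction m with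
  | zero => simp
  | succ m ih => rw [Function.iterate_succ_apply', ih]; push_cast; ring

theorem finrank_peircePart (d : ZMod n → ℤ) (l : ℤ) (b a : ZMod n) :
    Module.finrank k (N.peircePart d l b a) =
      ((Finset.range (N.height b)).filter fun j : ℕ =>
        b + (j : ZMod n) = a ∧ (⟨b, j⟩ : CyclicPath n).degree d = l).card := by
  classical
  rw [peircePart, degreePart, N.finrank_map_span_path _ _
    (((Finset.range (N.height b)).filter fun j : ℕ =>
        b + (j : ZMod n) = a ∧ (⟨b, j⟩ : CyclicPath n).degree d = l).image fun j => ⟨b, j⟩)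
      (fun p => p.src = b ∧ p.tgt = a), Finset.card_image_of_injective]
  · intro i j h
    exact congrArg CyclicPath.length h
  · intro p hp
    rw [LinearMap.comp_apply, LinearMap.mulLeft_apply, LinearMap.mulRight_apply, path_mul_idem,
      if_pos hp.2, idem_mul_path, if_pos hp.1]
  · intro p hp
    rw [LinearMap.comp_apply, LinearMap.mulLeft_apply, LinearMap.mulRight_apply, path_mul_idem]
    split_ifs with h
    · rw [idem_mul_path, if_neg fun h' => hp ⟨h', h⟩]
    · simp
  · intro p
    simp only [Finset.mem_image, Finset.mem_filter, Finset.mem_range, Set.mem_ofPred_eq]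
    constructor
    · rintro ⟨j, ⟨h1, h2, h3⟩, rfl⟩; exact ⟨h3, ⟨rfl, h2⟩, h1⟩
    · rintro ⟨h3, ⟨rfl, h2⟩, h⟩; exact ⟨p.length, ⟨h, h2, h3⟩, rfl⟩

theorem gradedCartan_apply (d : ZMod n → ℤ) (a b : ZMod n) :
    N.gradedCartan d a b = ∑ j ∈ (Finset.range (N.height b)).filter fun j : ℕ =>
        b + (j : ZMod n) = a, LaurentPolynomial.T ((⟨b, j⟩ : CyclicPath n).degree d) := by
  classical
  set S := (Finset.range (N.height b)).filter fun j : ℕ => b + (j : ZMod n) = a with hS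
  set g : ℕ → ℤ := fun j => (⟨b, j⟩ : CyclicPath n).degree d with hg
  have h : ∀ l : ℤ, LaurentPolynomial.C (Module.finrank k (N.peircePart d l b a) : ℤ) *
      LaurentPolynomial.T l = ∑ j ∈ S, if g j = l then LaurentPolynomial.T l else 0 := by
    intro l
    rw [finrank_peircePart, ← Finset.filter_filter, ← Finset.sum_filter, Finset.sum_const,
      nsmul_eq_mul]
    simp [hS, hg]
  rw [gradedCartan, Matrix.of_apply, finsum_congr h,
    finsum_eq_sum_of_support_subset (s := S.image g), Finset.sum_comm]
  · refine Finset.sum_congr rfl fun j hj => ?_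
    rw [Finset.sum_eq_single (g j)]
    · rw [if_pos rfl]
    · intro l _ hl; rw [if_neg hl.symm]
    · intro h; exact absurd (Finset.mem_image_of_mem g hj) h
  · intro l hl
    rw [Function.mem_support] at hl
    obtain ⟨j, hj, hne⟩ := Finset.exists_ne_zero_of_sum_ne_zero hl
    rw [Finset.mem_coe, Finset.mem_image]
    refine ⟨j, hj, ?_⟩
    by_contra h
    simp [h] at hne

end NakayamaPresentation

/-! ### Combinatorics: periodic points, the lift of `γ` to `ℤ` and its left adjoint. -/

theorem GaloisConnection.iterate_self {α : Type*} [Preorder α] {f g : α → α}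
    (h : GaloisConnection f g) (m : ℕ) : GaloisConnection f^[m] g^[m] := by
  induction m with
  | zero => exact GaloisConnection.id
  | succ m ih =>
    rw [Function.iterate_succ' f, Function.iterate_succ g]
    exact ih.compose h

/-- In a finite set, the image of a high iterate of a self-map consists of periodic points. -/
theorem exists_iterate_eq_self_of_iterate_card {V : Type*} [Fintype V] (γ : V → V) {y a : V}
    (h : γ^[Fintype.card V] y = a) : ∃ m, 0 < m ∧ γ^[m] a = a := by
  obtain ⟨i, j, hij, e⟩ := Fintype.exists_ne_map_eq_of_card_lt
    (fun i : Fin (Fintype.card V + 1) => γ^[i] y) (by simp)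
  wlog hlt : i < j generalizing i j
  · exact this j i hij.symm e.symm (lt_of_le_of_ne (not_lt.1 hlt) hij.symm)
  have hlt' : (i : ℕ) < j := hlt
  refine ⟨j - i, by omega, ?_⟩
  have e : γ^[i] y = γ^[j] y := e
  have hi := i.2
  have h1 : γ^[Fintype.card V - i] (γ^[i] y) = a := by
    rw [← Function.iterate_add_apply, show Fintype.card V - i + i = Fintype.card V by omega, h]
  rw [← h1]
  conv_rhs => rw [e]
  simp only [← Function.iterate_add_apply]
  congr 1
  omega

/-- Some iterate of a self-map of a finite set is a projection onto the periodic points. -/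
theorem exists_iterate_idempotent {V : Type*} [Fintype V] [Nonempty V] (γ : V → V) :
    ∃ M, (∀ x, (∃ m, 0 < m ∧ γ^[m] x = x) → γ^[M + 1] x = x) ∧
      ∀ x y, γ^[M + 1] y = x → ∃ m, 0 < m ∧ γ^[m] x = x := by
  classical
  have hN : 0 < Fintype.card V := Fintype.card_pos
  choose! p hp using fun (x : V) (h : ∃ m, 0 < m ∧ γ^[m] x = x) => h
  set P := ∏ x ∈ Finset.univ.filter (fun x : V => ∃ m, 0 < m ∧ γ^[m] x = x), p x with hP
  have hPpos : 0 < P := Finset.prod_pos fun x hx => (hp x (Finset.mem_filter.1 hx).2).1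
  have hle : Fintype.card V ≤ Fintype.card V * P := Nat.le_mul_of_pos_right _ hPpos
  -- The exponent is a multiple of every period, so it fixes periodic points, and is at least the
  -- number of points, so its image is periodic.
  refine ⟨Fintype.card V * P - 1, ?_⟩
  rw [Nat.sub_add_cancel (by omega)]
  constructor
  · intro x hx
    have hdvd : p x ∣ P := Finset.dvd_prod_of_mem p (Finset.mem_filter.2 ⟨Finset.mem_univ x, hx⟩)
    obtain ⟨c, hc⟩ := hdvd.mul_left (Fintype.card V)
    rw [hc, Function.iterate_mul]
    exact Function.iterate_fixed (hp x hx).2 c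
  · intro x y hxy
    refine exists_iterate_eq_self_of_iterate_card γ
      (y := γ^[Fintype.card V * P - Fintype.card V] y) ?_
    rw [← Function.iterate_add_apply, Nat.add_sub_of_le hle, hxy]

/-- One step of the passage from an interval `[b, a)` to the interval `[f a, b)`. -/
def cosyzygyStep (f : ℤ → ℤ) (p : ℤ × ℤ) : ℤ × ℤ := (f p.2, p.1)

theorem cosyzygyStep_iterate_two_mul (f : ℤ → ℤ) (b a : ℤ) (m : ℕ) :
    (cosyzygyStep f)^[2 * m] (b, a) = (f^[m] b, f^[m] a) := by
  induction m with
  | zero => rfl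
  | succ m ih =>
    rw [show 2 * (m + 1) = 2 * m + 1 + 1 by ring, Function.iterate_succ_apply',
      Function.iterate_succ_apply', ih, Function.iterate_succ_apply', Function.iterate_succ_apply']
    rfl

theorem cosyzygyStep_iterate_two_mul_add_one (f : ℤ → ℤ) (b a : ℤ) (m : ℕ) :
    (cosyzygyStep f)^[2 * m + 1] (b, a) = (f^[m + 1] a, f^[m] b) := by
  rw [Function.iterate_succ_apply', cosyzygyStep_iterate_two_mul, Function.iterate_succ_apply']
  rfl

/-- The lift of the map `a ↦ a + h a` from `ZMod n` to `ℤ`. -/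
def liftedShift {n : ℕ} (h : ZMod n → ℕ) (i : ℤ) : ℤ := i + h i

section

variable {n : ℕ} {h : ZMod n → ℕ}

theorem liftedShift_cast (i : ℤ) : ((liftedShift h i : ℤ) : ZMod n) = (i : ZMod n) + h i := by
  simp [liftedShift]

theorem liftedShift_iterate_cast {γ : ZMod n → ZMod n} (hγ : ∀ a, γ a = a + h a) (m : ℕ) (i : ℤ) :
    (((liftedShift h)^[m] i : ℤ) : ZMod n) = γ^[m] i := by
  induction m with
  | zero => rfl
  | succ m ih => rw [Function.iterate_succ_apply', liftedShift_cast, ih,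
      Function.iterate_succ_apply', hγ]

theorem liftedShift_iterate_add_mul (m : ℕ) (i c : ℤ) :
    (liftedShift h)^[m] (i + n * c) = (liftedShift h)^[m] i + n * c := by
  induction m with
  | zero => rfl
  | succ m ih =>
    rw [Function.iterate_succ_apply', ih, Function.iterate_succ_apply', liftedShift, liftedShift]
    simp
    ring

theorem liftedShift_mono (hh : ∀ (a : ZMod n) (m : ℕ), h a ≤ m + h (a + m)) : Monotone (liftedShift h) := by
  intro i j hij
  obtain ⟨m, rfl⟩ := Int.exists_add_of_le hij
  have := hh i m
  simp only [liftedShift]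
  push_cast
  omega

/-- The lift is monotone and differs from the identity by a bounded amount, so `f x` can be taken as
the least `i` whose image is at least `x`. -/
theorem exists_galoisConnection_liftedShift [NeZero n] (hh : ∀ (a : ZMod n) (m : ℕ), h a ≤ m + h (a + m)) :
    ∃ f : ℤ → ℤ, GaloisConnection f (liftedShift h) := by
  have hB : ∀ a, h a ≤ ∑ b, h b := fun a => Finset.single_le_sum (f := h)
    (fun _ _ => Nat.zero_le _) (Finset.mem_univ a)
  have key : ∀ x : ℤ, ∃ c, ∀ i, c ≤ i ↔ x ≤ liftedShift h i := by
    intro x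
    obtain ⟨c, hc, hmin⟩ := Int.exists_least_of_bdd (P := fun i => x ≤ liftedShift h i)
      ⟨x - ∑ b, h b, fun z hz => by
        have := hB z
        simp only [liftedShift] at hz
        have : (h z : ℤ) ≤ (∑ b, h b : ℕ) := by exact_mod_cast this
        omega⟩ ⟨x, by simp [liftedShift]⟩
    exact ⟨c, fun i => ⟨fun hi => hc.trans (liftedShift_mono hh hi), hmin i⟩⟩
  choose f hf using key
  exact ⟨f, hf⟩

/-- A periodic vertex has preimages under all iterates of the lifted map. -/
theorem exists_liftedShift_iterate_eq {γ : ZMod n → ZMod n} (hγ : ∀ a, γ a = a + h a) {x : ℤ}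
    (hx : ∃ m, 0 < m ∧ γ^[m] (x : ZMod n) = x) (r : ℕ) :
    ∃ i, (liftedShift h)^[r] i = x := by
  obtain ⟨m, hm, e⟩ := hx
  have e2 : γ^[r * m] (x : ZMod n) = x := by
    rw [mul_comm, Function.iterate_mul]
    exact Function.iterate_fixed e r
  have hle : r ≤ r * m := Nat.le_mul_of_pos_right r hm
  rw [← Nat.add_sub_of_le hle, ← liftedShift_iterate_cast hγ, ZMod.intCast_eq_intCast_iff_dvd_sub]
    at e2
  obtain ⟨c, hc⟩ := e2
  -- The lift returns to `x` only modulo `n`; starting from the translate by `n * c` corrects this.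
  refine ⟨(liftedShift h)^[r * m - r] (x + n * c), ?_⟩
  rw [← Function.iterate_add_apply, liftedShift_iterate_add_mul]
  omega

/-- If `x = G^r i`, then `f^r x ≤ i`, so `f^r (x + 1) ≤ i`, and adjunction gives `x + 1 ≤ x`.
Periodic points lie in the image of every `G^r`. -/
theorem not_periodic_of_even_step {γ : ZMod n → ZMod n} (hγ : ∀ a, γ a = a + h a) {f : ℤ → ℤ}
    (hf : GaloisConnection f (liftedShift h)) {x : ℤ} {r : ℕ} (hr : f^[r] (x + 1) ≤ f^[r] x) :
    ¬ ∃ m, 0 < m ∧ γ^[m] (x : ZMod n) = x := by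
  intro hx
  obtain ⟨i, hi⟩ := exists_liftedShift_iterate_eq hγ hx r
  have h1 : f^[r] x ≤ i := (hf.iterate_self r _ _).2 hi.ge
  have := (hf.iterate_self r _ _).1 (hr.trans h1)
  omega

/-- If `j = G^r i`, then `x + 1 ≤ G j = G^{r+1} i`, so `f^r x ≤ f^{r+1} (x + 1) ≤ i` and `x ≤ j`,
against `j < x`. -/
theorem not_periodic_of_odd_step {γ : ZMod n → ZMod n} (hγ : ∀ a, γ a = a + h a) {f : ℤ → ℤ}
    (hf : GaloisConnection f (liftedShift h)) {x : ℤ} {r : ℕ} (hr : f^[r] x ≤ f^[r + 1] (x + 1))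
    {j : ℤ} (hj : f (x + 1) ≤ j) (hjx : j < x) :
    ¬ ∃ m, 0 < m ∧ γ^[m] (j : ZMod n) = j := by
  intro hx
  obtain ⟨i, hi⟩ := exists_liftedShift_iterate_eq hγ hx r
  have h1 : f^[r + 1] (x + 1) ≤ i := by
    rw [hf.iterate_self (r + 1), Function.iterate_succ_apply', hi]
    exact (hf _ _).1 hj
  have := (hf.iterate_self r _ _).1 (hr.trans h1)
  omega

/-- Adjunction forces `G^n (f^n x) = x`. There are `n` vertices, so the image of `γ^n` is periodic.
-/
theorem periodic_of_even_step [NeZero n] {γ : ZMod n → ZMod n} (hγ : ∀ a, γ a = a + h a)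
    {f : ℤ → ℤ} (hf : GaloisConnection f (liftedShift h)) {x : ℤ}
    (hr : f^[n] x < f^[n] (x + 1)) : ∃ m, 0 < m ∧ γ^[m] (x : ZMod n) = x := by
  have h1 := (hf.iterate_self n _ _).1 (le_refl (f^[n] x))
  have h2 : ¬ x + 1 ≤ (liftedShift h)^[n] (f^[n] x) := by
    rw [← hf.iterate_self n]; omega
  refine exists_iterate_eq_self_of_iterate_card γ (y := (f^[n] x : ℤ)) ?_
  rw [ZMod.card, ← liftedShift_iterate_cast hγ, show (liftedShift h)^[n] (f^[n] x) = x by omega]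

theorem exists_periodic_of_odd_step [NeZero n] {γ : ZMod n → ZMod n} (hγ : ∀ a, γ a = a + h a)
    {f : ℤ → ℤ} (hf : GaloisConnection f (liftedShift h)) {x : ℤ}
    (hr : f^[n + 1] (x + 1) < f^[n] x) :
    ∃ j, f (x + 1) ≤ j ∧ j < x ∧ ∃ m, 0 < m ∧ γ^[m] (j : ZMod n) = j := by
  -- A value of `G^n` is automatically periodic; the unit of the adjunction for `n + 1` gives the
  -- lower bound, and `hr` the upper one.
  refine ⟨(liftedShift h)^[n] (f^[n + 1] (x + 1)), ?_, ?_, ?_⟩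
  · rw [hf, ← Function.iterate_succ_apply' (liftedShift h), ← hf.iterate_self (n + 1)]
  · by_contra hc
    rw [not_lt, ← hf.iterate_self n] at hc
    omega
  · refine exists_iterate_eq_self_of_iterate_card γ (y := (f^[n + 1] (x + 1) : ℤ)) ?_
    rw [ZMod.card, ← liftedShift_iterate_cast hγ]

end

/-! ### Interval modules and their injective resolutions. -/

namespace NakayamaPresentation

variable {k : Type u} [Field k] {n : ℕ} [NeZero n] {A : Type v} [Ring A] [Algebra k A]
  (N : NakayamaPresentation k n A)

open Classical in
theorem coeff_path_mul_path (b : ZMod n) (j : ℕ) (p q : CyclicPath n) :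
    N.coeff ⟨b, j⟩ (N.path p * N.path q) =
      if q.src = p.tgt ∧ (p.src = b ∧ p.length + q.length = j) ∧ j < N.height b then 1 else 0 := by
  rw [path_mul_path]
  by_cases h : q.src = p.tgt
  · rw [if_pos h, coeff_path]
    simp only [CyclicPath.ext_iff, CyclicPath.comp, h, true_and]
  · rw [if_neg h, map_zero, if_neg fun h' => h h'.1]

open Classical in
theorem coeff_mul_path (b : ZMod n) (j : ℕ) (x : A) (q : CyclicPath n) :
    N.coeff ⟨b, j⟩ (x * N.path q) =
      if q.length ≤ j ∧ j < N.height b ∧ q.src = b + (j - q.length : ℕ)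
      then N.coeff ⟨b, j - q.length⟩ x else 0 := by
  have h : N.coeff ⟨b, j⟩ ∘ₗ LinearMap.mulRight k (N.path q) =
      if q.length ≤ j ∧ j < N.height b ∧ q.src = b + (j - q.length : ℕ)
      then N.coeff ⟨b, j - q.length⟩ else 0 := by
    apply N.linearMap_ext
    intro p _
    rw [LinearMap.comp_apply, LinearMap.mulRight_apply, coeff_path_mul_path]
    rw [apply_ite (fun f : A →ₗ[k] k => f (N.path p)), LinearMap.zero_apply, coeff_path,
      ← ite_and]
    refine if_congr ?_ rfl rfl
    rw [CyclicPath.ext_iff]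
    constructor
    · rintro ⟨h1, ⟨rfl, rfl⟩, h2⟩
      rw [Nat.add_sub_cancel]
      exact ⟨⟨by omega, h2, h1⟩, ⟨rfl, rfl⟩, by omega⟩
    · rintro ⟨⟨h1, h2, h3⟩, ⟨h4, h5⟩, -⟩
      simp only at h4 h5
      refine ⟨?_, ⟨h4, by omega⟩, h2⟩
      rw [h3, CyclicPath.tgt, h4, h5]
  have := congrArg (fun f => f x) h
  rw [apply_ite (fun f : A →ₗ[k] k => f x)] at this
  simpa using this

open Classical in
theorem coeff_path_mul (b : ZMod n) (j : ℕ) (p : CyclicPath n) (x : A) :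
    N.coeff ⟨b, j⟩ (N.path p * x) =
      if p.src = b ∧ p.length ≤ j ∧ j < N.height b
      then N.coeff ⟨p.tgt, j - p.length⟩ x else 0 := by
  have h : N.coeff ⟨b, j⟩ ∘ₗ LinearMap.mulLeft k (N.path p) =
      if p.src = b ∧ p.length ≤ j ∧ j < N.height b
      then N.coeff ⟨p.tgt, j - p.length⟩ else 0 := by
    apply N.linearMap_ext
    intro q hq
    rw [LinearMap.comp_apply, LinearMap.mulLeft_apply, coeff_path_mul_path]
    rw [apply_ite (fun f : A →ₗ[k] k => f (N.path q)), LinearMap.zero_apply, coeff_path,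
      ← ite_and]
    refine if_congr ?_ rfl rfl
    rw [CyclicPath.ext_iff]
    constructor
    · rintro ⟨h1, ⟨rfl, rfl⟩, h2⟩
      rw [Nat.add_sub_cancel_left]
      exact ⟨⟨rfl, by omega, h2⟩, ⟨h1, rfl⟩, by rw [← h1]; exact hq⟩
    · rintro ⟨⟨h1, h2, h3⟩, ⟨h4, h5⟩, -⟩
      simp only at h4 h5
      exact ⟨h4, ⟨h1, by omega⟩, h3⟩
  have := congrArg (fun f => f x) h
  rw [apply_ite (fun f : A →ₗ[k] k => f x)] at this
  simpa using this

theorem induction {P : A → Prop} (x : A) (h0 : P 0) (hadd : ∀ x y, P x → P y → P (x + y))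
    (hpath : ∀ (c : k) (p : CyclicPath n), P (c • N.path p)) : P x := by
  obtain ⟨x, rfl⟩ := N.proj_surjective x
  refine CyclicPathAlgebra.induction (P := fun x => P (N.proj x)) x (by simpa using h0) ?_ ?_
  · intro x y hx hy; rw [map_add]; exact hadd _ _ hx hy
  · intro c p; rw [map_smul]; exact hpath c p

/-- The right ideal whose quotient is the uniserial right module with top `S_b` and length `l`
(if `l` is at most the dimension of `e_b A`). -/
noncomputable def intervalIdeal (b : ZMod n) (l : ℕ) : Submodule Aᵐᵒᵖ A where
  carrier := {x | ∀ j < l, N.coeff ⟨b, j⟩ x = 0}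
  zero_mem' := by simp
  add_mem' := by
    intro x y hx hy j hj
    rw [map_add, hx j hj, hy j hj, add_zero]
  smul_mem' := by
    intro a x hx j hj
    rw [MulOpposite.smul_eq_mul_unop]
    refine N.induction (P := fun a => N.coeff ⟨b, j⟩ (x * a) = 0) _ (by simp) ?_ ?_
    · intro a a' h h'; rw [mul_add, map_add, h, h', add_zero]
    · intro c p
      rw [mul_smul_comm, map_smul, coeff_mul_path]
      split_ifs
      · rw [hx _ (by omega), smul_zero]
      · simp

theorem smul_mem_of_mem (K : Submodule Aᵐᵒᵖ A) (c : k) {x : A} (hx : x ∈ K) : c • x ∈ K :=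
  (K.restrictScalars k).smul_mem c hx

/-- Modulo arrows and the other idempotents, every element is its coefficient at `e_a` times `e_a`.
-/
theorem simpleIdeal_eq (a : ZMod n) : N.simpleIdeal a = N.intervalIdeal a 1 := by
  classical
  apply le_antisymm
  · rw [simpleIdeal, Submodule.span_le]
    rintro _ (⟨c, rfl⟩ | ⟨c, hc, rfl⟩) j hj
    · rw [arr, coeff_path, if_neg]
      rintro ⟨h, -⟩
      have := congrArg CyclicPath.length h
      simp only [CyclicPath.arrow] at this
      omega
    · rw [idem, coeff_path, if_neg]
      rintro ⟨h, -⟩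
      exact hc (congrArg CyclicPath.src h)
  · intro x hx
    have key : x - N.coeff ⟨a, 0⟩ x • N.idem a ∈ N.simpleIdeal a := by
      refine N.induction (P := fun x => x - N.coeff ⟨a, 0⟩ x • N.idem a ∈ N.simpleIdeal a) x
        (by simp) ?_ ?_
      · intro x y hx hy
        rw [map_add, add_smul, add_sub_add_comm]
        exact add_mem hx hy
      · intro c p
        rw [map_smul, smul_assoc, ← smul_sub]
        apply smul_mem_of_mem
        rw [coeff_path]
        rcases p with ⟨s, l⟩
        rcases l with - | l
        · by_cases hs : s = a
          · subst hs
            rw [if_pos ⟨rfl, N.height_pos _⟩, one_smul, idem, CyclicPath.triv, sub_self]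
            exact zero_mem _
          · rw [if_neg fun h => hs (congrArg CyclicPath.src h.1), zero_smul, sub_zero]
            exact Submodule.subset_span (Or.inr ⟨s, hs, rfl⟩)
        · rw [if_neg fun h => absurd (congrArg CyclicPath.length h.1) (by simp), zero_smul,
            sub_zero]
          have : N.path ⟨s, l + 1⟩ = MulOpposite.op (N.path ⟨s + 1, l⟩) • N.arr s := by
            rw [op_smul_eq_mul, arr, path_mul_path, if_pos]
            · simp [CyclicPath.comp, CyclicPath.arrow, add_comm]
            · simp [CyclicPath.tgt, CyclicPath.arrow]
          rw [this]
          exact Submodule.smul_mem _ _ (Submodule.subset_span (Or.inl ⟨s, rfl⟩))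
    rw [hx 0 zero_lt_one, zero_smul, sub_zero] at key
    exact key

/-- The uniserial right module with top `S_b` and length `l`. -/
abbrev Interval (b : ZMod n) (l : ℕ) : Type v := A ⧸ N.intervalIdeal b l

/-- The coordinates on an interval module. -/
noncomputable def coord (b : ZMod n) (l j : ℕ) (hj : j < l) : N.Interval b l →ₗ[k] k :=
  ((N.intervalIdeal b l).restrictScalars k).liftQ (N.coeff ⟨b, j⟩)
    (fun _ hx => LinearMap.mem_ker.2 (hx j hj)) ∘ₗ
  ((Submodule.Quotient.restrictScalarsEquiv k (N.intervalIdeal b l)).symm).toLinearMap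

theorem coord_mk (b : ZMod n) (l j : ℕ) (hj : j < l) (x : A) :
    N.coord b l j hj (Submodule.Quotient.mk x) = N.coeff ⟨b, j⟩ x := rfl

theorem interval_ext {b : ZMod n} {l : ℕ} {x y : N.Interval b l}
    (h : ∀ j hj, N.coord b l j hj x = N.coord b l j hj y) : x = y := by
  obtain ⟨x, rfl⟩ := Submodule.Quotient.mk_surjective _ x
  obtain ⟨y, rfl⟩ := Submodule.Quotient.mk_surjective _ y
  rw [Submodule.Quotient.eq]
  intro j hj
  rw [map_sub, sub_eq_zero]
  exact h j hj

/-- Left multiplication by the path of length `i` shifts coordinates by `i`. The two directions make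
the induced map of intervals injective and well defined. -/
theorem path_mul_mem_intervalIdeal {c : ZMod n} {i l : ℕ} (hl : i + l ≤ N.height c) {x : A} :
    N.path ⟨c, i⟩ * x ∈ N.intervalIdeal c (i + l) ↔ x ∈ N.intervalIdeal (c + i) l := by
  constructor
  · intro h j hj
    have := h (i + j) (by omega)
    rwa [coeff_path_mul, if_pos ⟨rfl, by simp, by omega⟩, Nat.add_sub_cancel_left] at this
  · intro h j hj
    rw [coeff_path_mul]
    split_ifs with h1
    · exact h _ (by simp only at h1 ⊢; omega)
    · rfl

/-- The inclusion of a submodule of an interval module. -/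
noncomputable def intervalInclusion (c : ZMod n) (i l : ℕ) (hl : i + l ≤ N.height c) :
    N.Interval (c + i) l →ₗ[Aᵐᵒᵖ] N.Interval c (i + l) :=
  Submodule.mapQ _ _ (LinearMap.mulLeft Aᵐᵒᵖ (N.path ⟨c, i⟩))
    fun _ hx => (N.path_mul_mem_intervalIdeal hl).2 hx

theorem intervalInclusion_mk (c : ZMod n) (i l : ℕ) (hl : i + l ≤ N.height c) (x : A) :
    N.intervalInclusion c i l hl (Submodule.Quotient.mk x) =
      Submodule.Quotient.mk (N.path ⟨c, i⟩ * x) := rfl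

theorem intervalInclusion_injective (c : ZMod n) (i l : ℕ) (hl : i + l ≤ N.height c) :
    Function.Injective (N.intervalInclusion c i l hl) := by
  rw [injective_iff_map_eq_zero]
  intro x hx
  obtain ⟨x, rfl⟩ := Submodule.Quotient.mk_surjective _ x
  rw [intervalInclusion_mk, Submodule.Quotient.mk_eq_zero,
    N.path_mul_mem_intervalIdeal hl] at hx
  exact (Submodule.Quotient.mk_eq_zero _).2 hx

/-- The projection of an interval module onto a quotient. -/
noncomputable def intervalProjection (c : ZMod n) (i l : ℕ) :
    N.Interval c (i + l) →ₗ[Aᵐᵒᵖ] N.Interval c i :=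
  Submodule.mapQ _ _ LinearMap.id fun _ hx j hj => hx j (by omega)

theorem intervalProjection_mk (c : ZMod n) (i l : ℕ) (x : A) :
    N.intervalProjection c i l (Submodule.Quotient.mk x) = Submodule.Quotient.mk x := rfl

theorem interval_exact (c : ZMod n) (i l : ℕ) (hl : i + l ≤ N.height c) :
    Function.Exact (N.intervalInclusion c i l hl) (N.intervalProjection c i l) := by
  classical
  intro x
  obtain ⟨x, rfl⟩ := Submodule.Quotient.mk_surjective _ x
  rw [intervalProjection_mk, Submodule.Quotient.mk_eq_zero]
  constructor
  · intro hx
    -- The preimage is `x` with its coordinates shifted down by `i`.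
    refine ⟨Submodule.Quotient.mk (∑ j ∈ Finset.range l,
      N.coeff ⟨c, i + j⟩ x • N.path ⟨c + i, j⟩), ?_⟩
    rw [intervalInclusion_mk]
    apply N.interval_ext
    intro m hm
    rw [coord_mk, coord_mk, coeff_path_mul]
    split_ifs with h
    · simp only at h
      rw [map_sum, Finset.sum_eq_single (m - i)]
      · rw [map_smul, coeff_path, if_pos, show i + (m - i) = m by omega]
        · simp
        · refine ⟨rfl, ?_⟩
          have := N.height_le_add c i
          simp only [CyclicPath.tgt]
          omega
      · intro j _ hj
        rw [map_smul, coeff_path, if_neg, smul_zero]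
        rintro ⟨h', -⟩
        exact hj (congrArg CyclicPath.length h')
      · intro h'
        simp only [Finset.mem_range] at h'
        omega
    · exact (hx m (by simp only [true_and] at h; omega)).symm
  · rintro ⟨y, hy⟩ j hj
    obtain ⟨y, rfl⟩ := Submodule.Quotient.mk_surjective _ y
    rw [intervalInclusion_mk] at hy
    have := congrArg (N.coord c (i + l) j (by omega)) hy
    rw [coord_mk, coord_mk, coeff_path_mul, if_neg (by simp only; omega)] at this
    exact this.symm

/-- Every coordinate can be pushed into the socle, so a homomorphism into an interval is determined
by its last coordinate, a linear functional. -/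
theorem coord_smul_path (c : ZMod n) (l i : ℕ) (hi : i < l) (hl : l ≤ N.height c)
    (z : N.Interval c l) :
    N.coord c l (l - 1) (by omega) (MulOpposite.op (N.path ⟨c + i, l - 1 - i⟩) • z) =
      N.coord c l i hi z := by
  obtain ⟨x, rfl⟩ := Submodule.Quotient.mk_surjective _ z
  rw [← Submodule.Quotient.mk_smul, coord_mk, coord_mk, op_smul_eq_mul, coeff_mul_path, if_pos]
  · simp only
    rw [show l - 1 - (l - 1 - i) = i by omega]
  · simp only
    rw [show l - 1 - (l - 1 - i) = i by omega]
    exact ⟨by omega, by omega, rfl⟩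

/-- Only paths ending at `c + i` survive the product. One of length greater than `i` passes through
`c - 1`, and `hmax` kills its prolongation; the others start at some `c + j` with `j ≤ i`. -/
theorem sum_coeff_functional (c : ZMod n) (l i : ℕ) (hi : i < l)
    (hmax : N.height (c - 1) ≤ l) (μ : Aᵐᵒᵖ →ₗ[k] k) (a : A) :
    μ (MulOpposite.op (a * N.path ⟨c + i, l - 1 - i⟩)) =
      ∑ j ∈ Finset.range (i + 1), μ (MulOpposite.op (N.path ⟨c + j, l - 1 - j⟩)) *
        N.coeff ⟨c + j, i - j⟩ a := by
  classical
  have h : μ ∘ₗ (MulOpposite.opLinearEquiv k).toLinearMap ∘ₗ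
      LinearMap.mulRight k (N.path ⟨c + i, l - 1 - i⟩) =
      ∑ j ∈ Finset.range (i + 1), μ (MulOpposite.op (N.path ⟨c + j, l - 1 - j⟩)) •
        N.coeff ⟨c + j, i - j⟩ := by
    apply N.linearMap_ext
    intro q hq
    simp only [LinearMap.comp_apply, LinearMap.mulRight_apply, LinearEquiv.coe_coe,
      MulOpposite.coe_opLinearEquiv, LinearMap.sum_apply, LinearMap.smul_apply, smul_eq_mul]
    rw [path_mul_path]
    by_cases hqi : q.length ≤ i
    · by_cases ht : c + i = q.tgt
      · have hs : q.src = c + (i - q.length : ℕ) := by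
          rw [Nat.cast_sub hqi, ← add_sub_assoc, ht, CyclicPath.tgt]
          ring
        rw [if_pos ht, Finset.sum_eq_single (i - q.length)]
        · have hq' : q = ⟨c + (i - q.length : ℕ), i - (i - q.length)⟩ := by
            ext
            · exact hs
            · simp only; omega
          rw [coeff_path, if_pos ⟨hq', by rw [← hq']; exact hq⟩, mul_one]
          congr 3
          ext
          · exact hs
          · simp only [CyclicPath.comp]; omega
        · intro j hj hne
          rw [coeff_path, if_neg, mul_zero]
          rintro ⟨h', -⟩
          have := congrArg CyclicPath.length h'
          simp only [Finset.mem_range] at hj this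
          omega
        · intro h'
          simp only [Finset.mem_range] at h'
          omega
      · rw [if_neg ht, MulOpposite.op_zero, map_zero, Finset.sum_eq_zero]
        intro j hj
        rw [coeff_path, if_neg, mul_zero]
        rintro ⟨h', -⟩
        apply ht
        rw [h', CyclicPath.tgt, add_assoc, ← Nat.cast_add,
          Nat.add_sub_of_le (by simp only [Finset.mem_range] at hj; omega)]
    · rw [Finset.sum_eq_zero]
      · split_ifs with ht
        · rw [path_eq_zero]
          · simp
          · have h1 := N.height_le_add q.src (q.length - i - 1)
            have h2 : q.src + (q.length - i - 1 : ℕ) = c - 1 := by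
              have ht : c + i = q.src + q.length := ht
              rw [Nat.sub_sub, Nat.cast_sub (by omega), ← add_sub_assoc, ← ht]
              push_cast
              ring
            rw [h2] at h1
            simp only [CyclicPath.comp]
            omega
        · simp
      · intro j hj
        rw [coeff_path, if_neg, mul_zero]
        rintro ⟨h', -⟩
        have := congrArg CyclicPath.length h'
        simp only at this
        omega
  have := congrArg (fun f => f a) h
  simpa using this

/-- An interval module that cannot be extended to the left is injective. -/
theorem interval_injective (c : ZMod n) (l : ℕ) (hl : l ≤ N.height c)
    (hmax : N.height (c - 1) ≤ l) : Module.Injective Aᵐᵒᵖ (N.Interval c l) := by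
  have hpos : 0 < l := (N.height_pos _).trans_le hmax
  apply Module.Baer.injective
  intro I g
  -- Baer's criterion: over the field, extend the socle coordinate of `g` from `I` to the whole
  -- ring.
  obtain ⟨μ, hμ⟩ := LinearMap.exists_extend (p := I.restrictScalars k)
    (N.coord c l (l - 1) (by omega) ∘ₗ (g.restrictScalars k))
  have hμ' : ∀ x (hx : x ∈ I), μ x = N.coord c l (l - 1) (by omega) (g ⟨x, hx⟩) :=
    fun x hx => congrArg (fun f => f ⟨x, hx⟩) hμ
  -- The image of `1` is forced: its `j`th coordinate is the last coordinate of its product with the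
  -- path from `c + j` to the socle, which must be `μ` of that path.
  set y : A := ∑ j ∈ Finset.range l,
    μ (MulOpposite.op (N.path ⟨c + j, l - 1 - j⟩)) • N.path ⟨c, j⟩ with hy
  refine ⟨LinearMap.toSpanSingleton Aᵐᵒᵖ _ (Submodule.Quotient.mk y), ?_⟩
  intro x hx
  rw [LinearMap.toSpanSingleton_apply]
  apply N.interval_ext
  intro i hi
  rw [← N.coord_smul_path c l i hi hl (g ⟨x, hx⟩), ← map_smul g, SetLike.mk_smul_mk, ← hμ',
    ← Submodule.Quotient.mk_smul, coord_mk]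
  obtain ⟨a, rfl⟩ := MulOpposite.op_surjective x
  rw [smul_eq_mul, ← MulOpposite.op_mul, N.sum_coeff_functional c l i hi hmax,
    op_smul_eq_mul, hy, Finset.sum_mul, map_sum]
  rw [← Finset.sum_subset (Finset.range_subset_range.2 (show i + 1 ≤ l by omega))]
  · refine Finset.sum_congr rfl fun j hj => ?_
    simp only [Finset.mem_range] at hj
    rw [smul_mul_assoc, map_smul, coeff_path_mul, if_pos ⟨rfl, by simp only; omega, by omega⟩]
    rfl
  · intro j hj hj'
    simp only [Finset.mem_range] at hj hj'
    rw [smul_mul_assoc, map_smul, coeff_path_mul, if_neg (by simp only; omega), smul_zero]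

theorem coeff_triv_one (b : ZMod n) : N.coeff ⟨b, 0⟩ 1 = 1 := by
  classical
  have h : (1 : A) = ∑ a, N.idem a := by
    rw [← map_one N.proj, CyclicPathAlgebra.one_def, map_sum]
    rfl
  rw [h, map_sum, Finset.sum_eq_single b]
  · rw [idem, coeff_path, if_pos ⟨rfl, N.height_pos _⟩]
  · intro a _ hab
    rw [idem, coeff_path, if_neg fun h => hab (congrArg CyclicPath.src h.1)]
  · simp

/-- An interval module that can be extended to the left is not injective. -/
theorem interval_not_injective (c : ZMod n) (i l : ℕ) (hl : i + l ≤ N.height c) (hi : 0 < i)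
    (hpos : 0 < l) : ¬ Module.Injective Aᵐᵒᵖ (N.Interval (c + i) l) := by
  intro h
  -- The inclusion would split. It sends the generator to a multiple of a path of length `i > 0`,
  -- which `r` maps to an element with zero top coordinate.
  obtain ⟨r, hr⟩ := h.out (N.intervalInclusion c i l hl) (N.intervalInclusion_injective c i l hl)
    LinearMap.id
  have h1 := hr (Submodule.Quotient.mk 1)
  rw [intervalInclusion_mk, mul_one, LinearMap.id_apply,
    show N.path ⟨c, i⟩ = MulOpposite.op (N.path ⟨c, i⟩) • 1 by rw [op_smul_eq_mul, one_mul],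
    Submodule.Quotient.mk_smul, map_smul] at h1
  obtain ⟨z, hz⟩ := Submodule.Quotient.mk_surjective _ (r (Submodule.Quotient.mk 1))
  rw [← hz, ← Submodule.Quotient.mk_smul] at h1
  have := congrArg (N.coord _ l 0 hpos) h1
  rw [coord_mk, coord_mk, coeff_triv_one, op_smul_eq_mul, coeff_mul_path,
    if_neg (by simp only; omega)] at this
  exact zero_ne_one this

theorem interval_subsingleton_iff (b : ZMod n) (l : ℕ) :
    Subsingleton (N.Interval b l) ↔ l = 0 := by
  constructor
  · intro h
    by_contra hl
    have := congrArg (N.coord b l 0 (by omega))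
      (Subsingleton.elim (Submodule.Quotient.mk 1 : N.Interval b l) 0)
    rw [coord_mk, coeff_triv_one, map_zero] at this
    exact one_ne_zero this
  · rintro rfl
    exact ⟨fun x y => N.interval_ext fun j hj => absurd hj (by omega)⟩

open CategoryTheory

theorem interval_shortExact (c : ZMod n) (i l : ℕ) (hl : i + l ≤ N.height c) :
    ∃ w, (ShortComplex.mk (ModuleCat.ofHom (N.intervalInclusion c i l hl))
      (ModuleCat.ofHom (N.intervalProjection c i l)) w).ShortExact := by
  refine ⟨?_, ModuleCat.shortComplex_shortExact _ (N.interval_exact c i l hl)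
    (N.intervalInclusion_injective c i l hl) ?_⟩
  · exact ModuleCat.hom_ext (LinearMap.ext fun x => (N.interval_exact c i l hl _).2 ⟨x, rfl⟩)
  · intro x
    obtain ⟨x, rfl⟩ := Submodule.Quotient.mk_surjective _ x
    exact ⟨Submodule.Quotient.mk x, rfl⟩

/-- The injective dimension of an interval module is determined by the sequence of its
cosyzygies, which are interval modules again. -/
theorem interval_hasInjectiveDimensionLT_iff {f : ℤ → ℤ}
    (hf : GaloisConnection f (liftedShift N.height)) (m : ℕ) (b a : ℤ) (hba : b ≤ a)
    (hG : a ≤ liftedShift N.height b) :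
    HasInjectiveDimensionLT (ModuleCat.of Aᵐᵒᵖ (N.Interval b (a - b).toNat)) m ↔
      ∃ j ≤ m, ((cosyzygyStep f)^[j] (b, a)).2 ≤ ((cosyzygyStep f)^[j] (b, a)).1 := by
  induction m using Nat.strong_induction_on generalizing b a with | _ m IH =>
  have hfb : f a ≤ b := (hf _ _).2 hG
  -- `hfa` makes `[f a, a)` an interval module, and `hmax` says that it cannot be extended to the
  -- left, so it is injective and contains `[b, a)`.
  have hfa : a ≤ liftedShift N.height (f a) := (hf _ _).1 le_rfl
  have hmax : liftedShift N.height (f a - 1) < a := by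
    by_contra h
    have := (hf _ _).2 (not_lt.1 h)
    omega
  obtain ⟨i, hi⟩ := Int.exists_add_of_le hfb
  set c := f a with hc
  set l := (a - b).toNat with hl
  simp only [liftedShift] at hG hfa hmax
  push_cast at hmax
  have hcast : ((b : ℤ) : ZMod n) = (c : ZMod n) + i := by rw [hi]; push_cast; rfl
  have hil : i + l ≤ N.height c := by omega
  have hinj : Injective (ModuleCat.of Aᵐᵒᵖ (N.Interval c (i + l))) := by
    rw [← Module.injective_iff_injective_object]
    exact N.interval_injective c (i + l) hil (by omega)
  obtain ⟨w, hS⟩ := N.interval_shortExact c i l hil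
  rw [hcast]
  -- Dimension shifting compares the bounds `m + 1` and `m + 2`, so the bounds `0` (zero module) and
  -- `1` (injective module) are settled directly.
  rcases m with - | m
  · rw [hasInjectiveDimensionLT_zero_iff_isZero, ModuleCat.isZero_iff_subsingleton]
    refine (N.interval_subsingleton_iff _ _).trans ⟨fun h => ⟨0, le_rfl, ?_⟩, ?_⟩
    · simp only [Function.iterate_zero, id_eq]; omega
    · rintro ⟨j, hj, h⟩
      obtain rfl : j = 0 := by omega
      simp only [Function.iterate_zero, id_eq] at h
      omega
  rcases m with - | m
  · rw [zero_add, ← injective_iff_hasInjectiveDimensionLT_one,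
      ← Module.injective_iff_injective_object]
    constructor
    · intro h
      by_cases hi0 : i = 0
      · exact ⟨1, le_rfl, by simp only [Function.iterate_one, cosyzygyStep]; omega⟩
      by_cases hl0 : l = 0
      · exact ⟨0, zero_le_one, by simp only [Function.iterate_zero, id_eq]; omega⟩
      exact absurd h (N.interval_not_injective c i l hil (by omega) (by omega))
    · rintro ⟨j, hj, h⟩
      have hor : i = 0 ∨ l = 0 := by
        obtain rfl | rfl : j = 0 ∨ j = 1 := by omega
        · right; simp only [Function.iterate_zero, id_eq] at h; omega
        · left; simp only [Function.iterate_one, cosyzygyStep] at h; omega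
      rcases hor with rfl | h0
      · rw [Nat.cast_zero, add_zero]
        exact N.interval_injective c l (by omega) (by omega)
      · have := (N.interval_subsingleton_iff ((c : ZMod n) + i) l).2 h0
        exact ⟨fun X Y _ _ _ _ f _ g => ⟨0, fun x => Subsingleton.elim _ _⟩⟩
  · have ih := IH (m + 1) (by omega) c b hfb
      (by simp only [liftedShift]; omega)
    rw [show (b - c).toNat = i by omega] at ih
    refine (hS.hasInjectiveDimensionLT_X₃_iff m hinj).symm.trans (ih.trans ?_)
    have hstep : ∀ j, (cosyzygyStep f)^[j + 1] (b, a) = (cosyzygyStep f)^[j] (c, b) :=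
      fun j => Function.iterate_succ_apply _ _ _
    constructor
    · rintro ⟨j, hj, h⟩
      exact ⟨j + 1, by omega, by rwa [hstep]⟩
    · rintro ⟨j, hj, h⟩
      rcases j with - | j
      -- If `[b, a)` is already empty, then `a = b`, and the interval after `(f a, b)` is `(f b, f
      -- a)`, again empty.
      · refine ⟨1, by omega, ?_⟩
        simp only [Function.iterate_zero, id_eq] at h
        simp only [Function.iterate_one, cosyzygyStep]
        rw [hc, le_antisymm h hba]
      · exact ⟨j, by omega, by rwa [← hstep]⟩

end NakayamaPresentation

/-! ### Values of rational functions at `t = 1`. -/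

namespace HasValueAtOne

theorem of_div {p q : Polynomial ℚ} (hq : q.eval 1 ≠ 0) :
    HasValueAtOne (algebraMap _ (RatFunc ℚ) p / algebraMap _ (RatFunc ℚ) q)
      (p.eval 1 / q.eval 1) := by
  have hq0 : q ≠ 0 := by rintro rfl; simp at hq
  set f := algebraMap _ (RatFunc ℚ) p / algebraMap _ (RatFunc ℚ) q with hf
  have hd : f.denom.eval 1 ≠ 0 := by
    obtain ⟨c, hc⟩ := RatFunc.denom_div_dvd p q
    intro h
    rw [← hf] at hc
    rw [hc, Polynomial.eval_mul, h, zero_mul] at hq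
    exact hq rfl
  refine ⟨hd, ?_⟩
  have h := (RatFunc.num_mul_eq_mul_denom_iff hq0).2 hf
  rw [RatFunc.eval, Polynomial.eval₂_id, Polynomial.eval₂_id, div_eq_div_iff hd hq,
    ← Polynomial.eval_mul, h, Polynomial.eval_mul]

theorem algebraMap (p : Polynomial ℚ) :
    HasValueAtOne (algebraMap _ (RatFunc ℚ) p) (p.eval 1) := by
  simpa using of_div (p := p) (q := 1) (by simp)

theorem X_pow (m : ℕ) : HasValueAtOne (RatFunc.X ^ m) 1 := by
  simpa using algebraMap (Polynomial.X ^ m)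

theorem one : HasValueAtOne 1 1 := by
  simpa using algebraMap 1

theorem unique {f : RatFunc ℚ} {a b : ℚ} (ha : HasValueAtOne f a) (hb : HasValueAtOne f b) :
    a = b := ha.2.symm.trans hb.2

theorem add {f g : RatFunc ℚ} {a b : ℚ} (hf : HasValueAtOne f a) (hg : HasValueAtOne g b) :
    HasValueAtOne (f + g) (a + b) := by
  refine ⟨fun h => ?_, ?_⟩
  · have := Polynomial.eval_eq_zero_of_dvd_of_eval_eq_zero (RatFunc.denom_add_dvd f g) h
    rw [Polynomial.eval_mul] at this
    exact mul_ne_zero hf.1 hg.1 this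
  · rw [RatFunc.eval_add, hf.2, hg.2]
    · rw [Polynomial.eval₂_id]; exact hf.1
    · rw [Polynomial.eval₂_id]; exact hg.1

theorem mul {f g : RatFunc ℚ} {a b : ℚ} (hf : HasValueAtOne f a) (hg : HasValueAtOne g b) :
    HasValueAtOne (f * g) (a * b) := by
  refine ⟨fun h => ?_, ?_⟩
  · have := Polynomial.eval_eq_zero_of_dvd_of_eval_eq_zero (RatFunc.denom_mul_dvd f g) h
    rw [Polynomial.eval_mul] at this
    exact mul_ne_zero hf.1 hg.1 this
  · rw [RatFunc.eval_mul, hf.2, hg.2]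
    · rw [Polynomial.eval₂_id]; exact hf.1
    · rw [Polynomial.eval₂_id]; exact hg.1

theorem sum {ι : Type*} (s : Finset ι) {f : ι → RatFunc ℚ} {a : ι → ℚ}
    (h : ∀ i ∈ s, HasValueAtOne (f i) (a i)) : HasValueAtOne (∑ i ∈ s, f i) (∑ i ∈ s, a i) := by
  classical
  induction s using Finset.induction_on with
  | empty => simpa using algebraMap 0
  | insert i s hi ih =>
    rw [Finset.sum_insert hi, Finset.sum_insert hi]
    exact (h i (Finset.mem_insert_self _ _)).add
      (ih fun j hj => h j (Finset.mem_insert_of_mem hj))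

end HasValueAtOne

/-! ### Linear systems along a functional graph. -/

section

variable {V : Type*} [Fintype V] [DecidableEq V]

/-- Iterating a linear system along the functional graph of `γ`. -/
theorem exists_iterated_system (γ : V → V) {e δ : V → ℕ} (he : ∀ i, 0 < e i) (hδ : ∀ i, 0 < δ i)
    {α : V → RatFunc ℚ}
    (hα : ∀ x, α x = 1 - RatFunc.X ^ δ x + ∑ i, if γ i = x then RatFunc.X ^ e i * α i else 0)
    (m : ℕ) :
    ∃ (Q : V → Polynomial ℚ) (E : V → ℕ), (∀ x, 0 < (Q x).eval 1) ∧ (∀ i, 0 < E i) ∧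
      ∀ x, α x = (1 - RatFunc.X) * algebraMap _ (RatFunc ℚ) (Q x) +
        ∑ i, if γ^[m + 1] i = x then RatFunc.X ^ E i * α i else 0 := by
  have hgeom : ∀ x, (1 : RatFunc ℚ) - RatFunc.X ^ δ x = (1 - RatFunc.X) *
      algebraMap _ (RatFunc ℚ) (∑ j ∈ Finset.range (δ x), (Polynomial.X : Polynomial ℚ) ^ j) := by
    intro x
    rw [map_sum]
    simp only [map_pow, RatFunc.algebraMap_X]
    rw [mul_neg_geom_sum]
  induction m with
  | zero =>
    refine ⟨fun x => ∑ j ∈ Finset.range (δ x), (Polynomial.X : Polynomial ℚ) ^ j, e, fun x => ?_, he, fun x => ?_⟩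
    · simpa [Polynomial.eval_finsetSum] using hδ x
    · rw [← hgeom]; exact hα x
  | succ m ih =>
    obtain ⟨Q, E, hQ, hE, h⟩ := ih
    refine ⟨fun x => Q x + ∑ i, if γ^[m + 1] i = x then
      Polynomial.X ^ E i * ∑ j ∈ Finset.range (δ i), (Polynomial.X : Polynomial ℚ) ^ j else 0,
      fun j => E (γ j) + e j, fun x => ?_, fun i => Nat.add_pos_right _ (he i), fun x => ?_⟩
    · rw [Polynomial.eval_add, Polynomial.eval_finsetSum]
      refine add_pos_of_pos_of_nonneg (hQ x) (Finset.sum_nonneg fun i _ => ?_)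
      split_ifs
      · simp [Polynomial.eval_finsetSum]
      · simp
    -- Substitute the original equation for each `α i`: exponents add along `γ`, and the constants
    -- `1 - X ^ δ i` are `1 - X` times a geometric sum.
    · have h1 : ∀ i, (if γ^[m + 1] i = x then RatFunc.X ^ E i * α i else 0) =
          (1 - RatFunc.X) * algebraMap _ (RatFunc ℚ) (if γ^[m + 1] i = x then
            Polynomial.X ^ E i * ∑ j ∈ Finset.range (δ i), (Polynomial.X : Polynomial ℚ) ^ j else 0) +
          ∑ j, if γ j = i then
            (if γ^[m + 1] i = x then RatFunc.X ^ E i * (RatFunc.X ^ e j * α j) else 0)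
            else 0 := by
        intro i
        split_ifs with hi
        · rw [hα i, hgeom, mul_add, Finset.mul_sum, map_mul, map_pow, RatFunc.algebraMap_X]
          simp only [mul_ite, mul_zero]
          ring
        · simp
      rw [h x, Finset.sum_congr rfl fun i _ => h1 i, Finset.sum_add_distrib, ← Finset.mul_sum,
        ← map_sum, ← add_assoc, ← mul_add, ← map_add, Finset.sum_comm]
      congr 1
      refine Finset.sum_congr rfl fun j _ => ?_
      rw [Finset.sum_ite_eq, if_pos (Finset.mem_univ _), Function.iterate_succ_apply γ (m + 1) j,
        pow_add, mul_assoc]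

/-- With `γ^[M + 1]` a projection onto the periodic points, the iterated equation for a periodic `x`
involves only `α x` and non-periodic terms, which are explicit multiples of `1 - X`. Cancelling `1 -
X` removes the apparent pole at `1`. -/
theorem exists_value_of_system [Nonempty V] (γ : V → V) {e δ : V → ℕ} (he : ∀ i, 0 < e i)
    (hδ : ∀ i, 0 < δ i) {α : V → RatFunc ℚ}
    (hα : ∀ x, α x = 1 - RatFunc.X ^ δ x + ∑ i, if γ i = x then RatFunc.X ^ e i * α i else 0) :
    ∃ v : V → ℚ, (∀ x, HasValueAtOne (α x) (v x)) ∧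
      (∀ x, (¬ ∃ m, 0 < m ∧ γ^[m] x = x) → v x = 0) ∧
      (∀ x, (∃ m, 0 < m ∧ γ^[m] x = x) → 0 < v x) ∧
      (∀ x, (∃ m, 0 < m ∧ γ^[m] x = x) → v (γ x) = v x) := by
  classical
  obtain ⟨M, hM1, hM2⟩ := exists_iterate_idempotent γ
  obtain ⟨Q, E, hQ, hE, h⟩ := exists_iterated_system γ he hδ hα M
  have hX1 : (1 : RatFunc ℚ) - RatFunc.X ≠ 0 := by
    intro h0
    have h1 : algebraMap _ (RatFunc ℚ) (Polynomial.X : Polynomial ℚ) = algebraMap _ _ 1 := by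
      rw [RatFunc.algebraMap_X, map_one]; exact (sub_eq_zero.1 h0).symm
    have := congrArg (Polynomial.eval 0) (RatFunc.algebraMap_injective ℚ h1)
    simp at this
  have hnon : ∀ x, (¬ ∃ m, 0 < m ∧ γ^[m] x = x) →
      α x = (1 - RatFunc.X) * algebraMap _ (RatFunc ℚ) (Q x) := by
    intro x hx
    rw [h x, Finset.sum_eq_zero, add_zero]
    intro i _
    rw [if_neg fun hi => hx (hM2 _ _ hi)]
  have hnonval : ∀ x, (¬ ∃ m, 0 < m ∧ γ^[m] x = x) → HasValueAtOne (α x) 0 := by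
    intro x hx
    rw [hnon x hx]
    convert HasValueAtOne.algebraMap ((1 - Polynomial.X) * Q x) using 1 <;> simp
  have hcyc : ∀ x, (∃ m, 0 < m ∧ γ^[m] x = x) → ∃ c, 0 < c ∧ HasValueAtOne (α x) c := by
    intro x hx
    set R : Polynomial ℚ := Q x + ∑ i ∈ Finset.univ.erase x,
      if γ^[M + 1] i = x then Polynomial.X ^ E i * Q i else 0 with hR
    set G : Polynomial ℚ := ∑ j ∈ Finset.range (E x), Polynomial.X ^ j with hG
    have hG1 : 0 < G.eval 1 := by
      simpa [hG, Polynomial.eval_finsetSum] using hE x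
    have hR1 : 0 < R.eval 1 := by
      rw [hR, Polynomial.eval_add, Polynomial.eval_finsetSum]
      refine add_pos_of_pos_of_nonneg (hQ x) (Finset.sum_nonneg fun i _ => ?_)
      split_ifs
      · simpa using (hQ i).le
      · simp
    have hG0 : algebraMap _ (RatFunc ℚ) G ≠ 0 := by
      intro h0
      rw [map_eq_zero_iff _ (RatFunc.algebraMap_injective ℚ)] at h0
      rw [h0] at hG1
      simp at hG1
    have hrest : ∀ i ∈ Finset.univ.erase x,
        (if γ^[M + 1] i = x then RatFunc.X ^ E i * α i else 0) =
        (1 - RatFunc.X) * algebraMap _ (RatFunc ℚ)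
          (if γ^[M + 1] i = x then Polynomial.X ^ E i * Q i else 0) := by
      intro i hi
      split_ifs with hix
      · rw [hnon i, map_mul, map_pow, RatFunc.algebraMap_X]
        · ring
        · intro hper
          exact (Finset.ne_of_mem_erase hi) ((hM1 i hper).symm.trans hix)
      · simp
    have key : (1 - RatFunc.X) * (algebraMap _ (RatFunc ℚ) G * α x) =
        (1 - RatFunc.X) * algebraMap _ (RatFunc ℚ) R := by
      have h1 := h x
      rw [← Finset.add_sum_erase _ _ (Finset.mem_univ x), if_pos (hM1 x hx),
        Finset.sum_congr rfl hrest, ← Finset.mul_sum, ← map_sum] at h1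
      have h2 : (1 - RatFunc.X) * algebraMap _ (RatFunc ℚ) G = 1 - RatFunc.X ^ E x := by
        rw [hG, map_sum]
        simp only [map_pow, RatFunc.algebraMap_X]
        rw [mul_neg_geom_sum]
      rw [← mul_assoc, h2, hR, map_add, mul_add, sub_mul, one_mul]
      nth_rw 1 [h1]
      ring
    refine ⟨R.eval 1 / G.eval 1, div_pos hR1 hG1, ?_⟩
    rw [show α x = algebraMap _ (RatFunc ℚ) R / algebraMap _ (RatFunc ℚ) G by
      rw [eq_div_iff hG0, mul_comm]; exact mul_left_cancel₀ hX1 key]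
    exact HasValueAtOne.of_div hG1.ne'
  have hall : ∀ x, ∃ c, HasValueAtOne (α x) c := fun x => by
    by_cases hx : ∃ m, 0 < m ∧ γ^[m] x = x
    · obtain ⟨c, -, hc⟩ := hcyc x hx; exact ⟨c, hc⟩
    · exact ⟨0, hnonval x hx⟩
  choose v hv using hall
  have hv0 : ∀ x, (¬ ∃ m, 0 < m ∧ γ^[m] x = x) → v x = 0 :=
    fun x hx => (hv x).unique (hnonval x hx)
  refine ⟨v, hv, hv0, fun x hx => ?_, fun x hx => ?_⟩
  · obtain ⟨c, hc0, hc⟩ := hcyc x hx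
    rwa [(hv x).unique hc]
  -- Evaluate the original equation of `γ x` at `1`. Non-periodic preimages contribute zero, and `x`
  -- is the only periodic one.
  · have h1 : HasValueAtOne (1 - RatFunc.X ^ δ (γ x) : RatFunc ℚ) 0 := by
      convert HasValueAtOne.algebraMap (1 - Polynomial.X ^ δ (γ x)) using 1 <;> simp
    have h2 : HasValueAtOne (∑ i, if γ i = γ x then RatFunc.X ^ e i * α i else 0)
        (∑ i, if γ i = γ x then 1 * v i else 0) := by
      refine HasValueAtOne.sum _ fun i _ => ?_
      split_ifs
      · exact (HasValueAtOne.X_pow _).mul (hv i)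
      · simpa using HasValueAtOne.algebraMap 0
    have h3 := h1.add h2
    rw [← hα] at h3
    rw [(hv _).unique h3, zero_add, Finset.sum_eq_single x]
    · simp
    · intro i _ hix
      split_ifs with hi
      · rw [hv0 i, mul_zero]
        intro hper
        apply hix
        rw [← hM1 i hper, ← hM1 x hx, Function.iterate_succ_apply, Function.iterate_succ_apply, hi]
      · rfl
    · simp

end

/-! ### The weighting and its linear system. -/

/-- The degree of the path of length `l` starting at `a`, for natural number degrees of arrows. -/
def pathWeight {n : ℕ} (D : ZMod n → ℕ) (a : ZMod n) (l : ℕ) : ℕ :=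
  ∑ i ∈ Finset.range l, D (a + i)

theorem pathWeight_toNat_succ {n : ℕ} (D : ZMod n → ℕ) {i x : ℤ} (hi : i < x) :
    pathWeight D i (x - i).toNat = pathWeight D i (x - 1 - i).toNat + D (x - 1) := by
  rw [show (x - i).toNat = (x - 1 - i).toNat + 1 by omega, pathWeight, Finset.sum_range_succ,
    pathWeight]
  congr 2
  have h : x - 1 = i + ((x - 1 - i).toNat : ℤ) := by omega
  have := congrArg (fun z : ℤ => (z : ZMod n)) h
  push_cast at this
  exact this.symm

theorem pathWeight_pos {n : ℕ} {D : ZMod n → ℕ} (hD : ∀ i, 0 < D i) (b : ZMod n) {l : ℕ} (hl : 0 < l) :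
    0 < pathWeight D b l :=
  Finset.sum_pos (fun _ _ => hD _) (Finset.nonempty_range_iff.2 hl.ne')

theorem laurentToRatFunc_T (m : ℕ) :
    laurentToRatFunc (LaurentPolynomial.T (m : ℤ)) = RatFunc.X ^ m := by
  rw [laurentToRatFunc, LaurentPolynomial.eval₂_T]
  simp

theorem Int.sum_Ico_consecutive {M : Type*} [AddCommMonoid M] (g : ℤ → M) {a b c : ℤ}
    (hab : a ≤ b) (hbc : b ≤ c) :
    ∑ i ∈ Finset.Ico a b, g i + ∑ i ∈ Finset.Ico b c, g i = ∑ i ∈ Finset.Ico a c, g i := by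
  rw [← Finset.Ico_union_Ico_eq_Ico hab hbc,
    Finset.sum_union (Finset.Ico_disjoint_Ico_consecutive a b c)]

namespace NakayamaPresentation

variable {k : Type u} [Field k] {n : ℕ} [NeZero n] {A : Type v} [Ring A] [Algebra k A]
  (N : NakayamaPresentation k n A)

theorem cartan_map_apply (D : ZMod n → ℕ) (a b : ZMod n) :
    ((N.gradedCartan fun i => (D i : ℤ)).map laurentToRatFunc) a b =
      ∑ j ∈ (Finset.range (N.height b)).filter fun j : ℕ => b + (j : ZMod n) = a,
        RatFunc.X ^ pathWeight D b j := by
  rw [Matrix.map_apply, gradedCartan_apply, map_sum]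
  refine Finset.sum_congr rfl fun j _ => ?_
  rw [← laurentToRatFunc_T]
  simp [CyclicPath.degree, pathWeight]

/-- The entries are polynomials. Positive degrees leave only the trivial paths at `t = 0`, where the
matrix is the identity, so the determinant is nonzero. -/
theorem isUnit_cartan (D : ZMod n → ℕ) (hD : ∀ i, 0 < D i) :
    IsUnit ((N.gradedCartan fun i => (D i : ℤ)).map laurentToRatFunc) := by
  set P : Matrix (ZMod n) (ZMod n) (Polynomial ℚ) := Matrix.of fun a b =>
    ∑ j ∈ (Finset.range (N.height b)).filter fun j : ℕ => b + (j : ZMod n) = a,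
      Polynomial.X ^ pathWeight D b j with hP
  have h1 : (N.gradedCartan fun i => (D i : ℤ)).map laurentToRatFunc =
      (algebraMap (Polynomial ℚ) (RatFunc ℚ)).mapMatrix P := by
    ext a b
    rw [cartan_map_apply]
    simp [hP, map_sum]
  have h2 : (Polynomial.evalRingHom (0 : ℚ)).mapMatrix P = 1 := by
    ext a b
    have hw : ∀ j, pathWeight D b j = 0 ↔ j = 0 := by
      intro j
      rw [pathWeight, Finset.sum_eq_zero_iff]
      constructor
      · intro h
        by_contra hj
        exact (hD _).ne' (h 0 (Finset.mem_range.2 (by omega)))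
      · rintro rfl; simp
    simp only [RingHom.mapMatrix_apply, Matrix.map_apply, hP, Matrix.of_apply,
      Polynomial.coe_evalRingHom, Polynomial.eval_finsetSum, Polynomial.eval_pow,
      Polynomial.eval_X, zero_pow_eq, hw]
    rw [Finset.sum_ite_eq', Matrix.one_apply]
    refine if_congr ?_ rfl rfl
    simp [N.height_pos, eq_comm]
  have h3 : P.det ≠ 0 := by
    intro h
    have := congrArg Matrix.det h2
    rw [← RingHom.map_det, h, map_zero, Matrix.det_one] at this
    exact zero_ne_one this
  rw [Matrix.isUnit_iff_isUnit_det, h1, ← RingHom.map_det, isUnit_iff_ne_zero]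
  rwa [Ne, map_eq_zero_iff _ (RatFunc.algebraMap_injective ℚ)]

theorem existsUnique_isWeighting (D : ZMod n → ℕ) (hD : ∀ i, 0 < D i) :
    ∃! α, IsWeighting ((N.gradedCartan fun i => (D i : ℤ)).map laurentToRatFunc) α := by
  have h := N.isUnit_cartan D hD
  obtain ⟨α, hα⟩ := Matrix.mulVec_surjective_iff_isUnit.2 h fun _ => 1
  exact ⟨α, hα, fun β hβ => Matrix.mulVec_injective_iff_isUnit.2 h (Eq.trans hβ hα.symm)⟩

/-- A nonzero path ending at `x` lifts uniquely to a path from some `i ≤ x` with `x < G i`, that is,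
`f (x + 1) ≤ i`. -/
theorem isWeighting_row {D : ZMod n → ℕ} {α : ZMod n → RatFunc ℚ}
    (hα : IsWeighting ((N.gradedCartan fun i => (D i : ℤ)).map laurentToRatFunc) α)
    {f : ℤ → ℤ} (hf : GaloisConnection f (liftedShift N.height)) (x : ℤ) :
    ∑ i ∈ Finset.Ico (f (x + 1)) (x + 1),
      RatFunc.X ^ pathWeight D i (x - i).toNat * α i = 1 := by
  have h := congrFun hα (x : ZMod n)
  rw [Matrix.mulVec, dotProduct] at h
  simp only [cartan_map_apply, Finset.sum_mul] at h
  rw [Finset.sum_sigma'] at h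
  rw [← h]
  refine Finset.sum_bij' (fun i _ => ⟨(i : ZMod n), (x - i).toNat⟩) (fun p _ => x - p.2)
    ?_ ?_ ?_ ?_ ?_
  · intro i hi
    rw [Finset.mem_Ico, hf, liftedShift] at hi
    rw [Finset.mem_sigma, Finset.mem_filter, Finset.mem_range]
    refine ⟨Finset.mem_univ _, by simp only; omega, ?_⟩
    have : (x : ℤ) = i + (x - i).toNat := by omega
    conv_rhs => rw [this]
    push_cast
    rfl
  · rintro ⟨b, j⟩ hp
    rw [Finset.mem_sigma, Finset.mem_filter, Finset.mem_range] at hp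
    obtain ⟨-, h1, h2⟩ := hp
    simp only at h1 h2
    have hb : ((x - j : ℤ) : ZMod n) = b := by push_cast; rw [← h2]; ring
    rw [Finset.mem_Ico, hf, liftedShift, hb]
    simp only
    omega
  · intro i hi
    rw [Finset.mem_Ico] at hi
    simp only
    omega
  · rintro ⟨b, j⟩ hp
    rw [Finset.mem_sigma, Finset.mem_filter, Finset.mem_range] at hp
    obtain ⟨-, h1, h2⟩ := hp
    simp only at h1 h2
    have hb : ((x - j : ℤ) : ZMod n) = b := by push_cast; rw [← h2]; ring
    simp only [hb]
    congr 1
    omega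
  · intro i hi
    rfl

/-- By adjunction `[f x, f (x + 1))` is the fibre of `G` over `x`; each `b` with `γ b = x` has
exactly one lift there, `x - p_b`. -/
theorem sum_preimage_gamma (D : ZMod n → ℕ) (α : ZMod n → RatFunc ℚ) {f : ℤ → ℤ}
    (hf : GaloisConnection f (liftedShift N.height)) (x : ℤ) :
    ∑ i ∈ Finset.Ico (f x) (f (x + 1)), RatFunc.X ^ pathWeight D i (x - i).toNat * α i =
      ∑ b, if N.gamma b = x then RatFunc.X ^ pathWeight D b (N.height b) * α b else 0 := by
  have hmem : ∀ i, i ∈ Finset.Ico (f x) (f (x + 1)) ↔ liftedShift N.height i = x := by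
    intro i
    rw [Finset.mem_Ico, hf, ← not_le, hf]
    omega
  rw [← Finset.sum_filter]
  refine Finset.sum_bij' (fun i _ => (i : ZMod n)) (fun b _ => x - N.height b) ?_ ?_ ?_ ?_ ?_
  · intro i hi
    rw [hmem] at hi
    rw [Finset.mem_filter, gamma_eq, ← liftedShift_cast, hi]
    exact ⟨Finset.mem_univ _, rfl⟩
  · intro b hb
    rw [Finset.mem_filter, gamma_eq] at hb
    have h : ((x - N.height b : ℤ) : ZMod n) = b := by push_cast; rw [← hb.2]; ring
    rw [hmem, liftedShift, h]
    omega
  · intro i hi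
    rw [hmem, liftedShift] at hi
    omega
  · intro b hb
    rw [Finset.mem_filter, gamma_eq] at hb
    push_cast
    rw [← hb.2]
    ring
  · intro i hi
    rw [hmem, liftedShift] at hi
    rw [show (x - i).toNat = N.height i by omega]

theorem galoisConnection_le_self {f : ℤ → ℤ}
    (hf : GaloisConnection f (liftedShift N.height)) (x : ℤ) : f (x + 1) ≤ x := by
  rw [hf, liftedShift]
  have := N.height_pos x
  omega

/-- The linear system obtained from a weighting by subtracting consecutive rows. -/
theorem isWeighting_system {D : ZMod n → ℕ} {α : ZMod n → RatFunc ℚ}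
    (hα : IsWeighting ((N.gradedCartan fun i => (D i : ℤ)).map laurentToRatFunc) α)
    (a : ZMod n) :
    α a = 1 - RatFunc.X ^ D (a - 1) +
      ∑ b, if N.gamma b = a then RatFunc.X ^ pathWeight D b (N.height b) * α b else 0 := by
  obtain ⟨f, hf⟩ := exists_galoisConnection_liftedShift N.height_le_add
  obtain ⟨x, rfl⟩ := ZMod.intCast_surjective a
  rw [← N.sum_preimage_gamma D α hf x]
  have h1 := N.isWeighting_row hα hf x
  have h2 := N.isWeighting_row hα hf (x - 1)
  have hfx : f x ≤ f (x + 1) := hf.monotone_l (by omega)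
  have hle := N.galoisConnection_le_self hf x
  rw [sub_add_cancel] at h2
  have h3 : ∑ i ∈ Finset.Ico (f x) x, RatFunc.X ^ pathWeight D i (x - i).toNat * α i =
      RatFunc.X ^ D (x - 1) := by
    rw [← mul_one (RatFunc.X ^ D (x - 1)), ← h2, Finset.mul_sum]
    refine Finset.sum_congr rfl fun i hi => ?_
    rw [pathWeight_toNat_succ D (Finset.mem_Ico.1 hi).2, pow_add]
    ring
  -- Rows `x` and (after scaling) `x - 1` share the range `[f (x + 1), x)`; the difference leaves `α
  -- x` and the fibre over `x`.
  rw [← Int.sum_Ico_consecutive _ hfx hle] at h3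
  rw [← Int.sum_Ico_consecutive _ hle (by omega : x ≤ x + 1),
    show Finset.Ico x (x + 1) = {x} by ext; simp; omega, Finset.sum_singleton, sub_self,
    show pathWeight D (x : ZMod n) (0 : ℤ).toNat = 0 from rfl, pow_zero, one_mul] at h1
  rw [← h3, ← h1]
  ring

theorem simpleInjDim_lt_iff {f : ℤ → ℤ} (hf : GaloisConnection f (liftedShift N.height)) (x : ℤ)
    (m : ℕ) : N.simpleInjDim x < m ↔
      ∃ j ≤ m, ((cosyzygyStep f)^[j] (x, x + 1)).2 ≤ ((cosyzygyStep f)^[j] (x, x + 1)).1 := by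
  have h : ∀ K L : Submodule Aᵐᵒᵖ A, K = L → CategoryTheory.injectiveDimension
      (ModuleCat.of Aᵐᵒᵖ (A ⧸ K)) = CategoryTheory.injectiveDimension
      (ModuleCat.of Aᵐᵒᵖ (A ⧸ L)) := by
    rintro K _ rfl; rfl
  rw [simpleInjDim, h _ _ (N.simpleIdeal_eq x), CategoryTheory.injectiveDimension_lt_iff,
    ← N.interval_hasInjectiveDimensionLT_iff hf m x (x + 1) (by omega)
      ((hf _ _).1 (N.galoisConnection_le_self hf x)), show (x + 1 - x).toNat = 1 by omega]

/-- The criterion holds for the bound `m + 1` but not for `m`, so the index it provides must be `m +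
1` itself. -/
theorem cosyzygy_empty_of_simpleInjDim_eq {f : ℤ → ℤ}
    (hf : GaloisConnection f (liftedShift N.height)) {x : ℤ} {m : ℕ} (h : N.simpleInjDim x = m) :
    ((cosyzygyStep f)^[m + 1] (x, x + 1)).2 ≤ ((cosyzygyStep f)^[m + 1] (x, x + 1)).1 := by
  have h1 : ¬ N.simpleInjDim x < m := by rw [h]; exact lt_irrefl _
  have h2 : N.simpleInjDim x < (m + 1 : ℕ) := by rw [h]; exact_mod_cast Nat.lt_succ_self m
  rw [N.simpleInjDim_lt_iff hf] at h1 h2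
  obtain ⟨j, hj, hle⟩ := h2
  rcases Nat.lt_or_ge m j with hlt | hge
  · obtain rfl : j = m + 1 := by omega
    exact hle
  · exact absurd ⟨j, hge, hle⟩ h1

theorem cosyzygy_nonempty_of_simpleInjDim_eq_top {f : ℤ → ℤ}
    (hf : GaloisConnection f (liftedShift N.height)) {x : ℤ} (h : N.simpleInjDim x = ⊤) (m : ℕ) :
    ((cosyzygyStep f)^[m] (x, x + 1)).1 < ((cosyzygyStep f)^[m] (x, x + 1)).2 := by
  by_contra hc
  have := (N.simpleInjDim_lt_iff hf x m).2 ⟨m, le_rfl, not_lt.1 hc⟩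
  rw [h] at this
  exact not_top_lt this

end NakayamaPresentation

/-! ### Comparison of the values at `t = 1` with the injective resolutions. -/

theorem proposition2p3 {k : Type u} [Field k] {n : ℕ} [NeZero n]
    {A : Type v} [Ring A] [Algebra k A] (N : NakayamaPresentation k n A)
    (d : ZMod n → ℤ) (hd : ∀ i, 0 < d i) :
    (∃! α : ZMod n → RatFunc ℚ, IsWeighting ((N.gradedCartan d).map laurentToRatFunc) α) ∧
    ∀ α : ZMod n → RatFunc ℚ, IsWeighting ((N.gradedCartan d).map laurentToRatFunc) α →
      ∃ v : ZMod n → ℚ, (∀ a, HasValueAtOne (α a) (v a)) ∧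
        (∀ a, (∃ m : ℕ, Odd m ∧ N.simpleInjDim a = m) → v a = 0) ∧
        (∀ a, (∃ m : ℕ, Even m ∧ N.simpleInjDim a = m) → v a = 1) ∧
        (∀ a, N.simpleInjDim a = ⊤ → 0 < v a ∧ v a < 1) ∧
        (∀ a, ¬ N.IsCyclicVertex a → v a = 0) ∧
        (∀ a b, N.OnSameCycle a b → v a = v b) := by
  obtain ⟨D, rfl⟩ : ∃ D : ZMod n → ℕ, d = fun i => (D i : ℤ) :=
    ⟨fun i => (d i).toNat, funext fun i => (Int.toNat_of_nonneg (hd i).le).symm⟩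
  have hD : ∀ i, 0 < D i := fun i => Int.natCast_pos.1 (hd i)
  refine ⟨N.existsUnique_isWeighting D hD, fun α hα => ?_⟩
  obtain ⟨v, hv, hv0, hvpos, hvγ⟩ := exists_value_of_system N.gamma
    (fun i => pathWeight_pos hD i (N.height_pos i)) (fun a => hD (a - 1))
    (N.isWeighting_system hα)
  obtain ⟨f, hf⟩ := exists_galoisConnection_liftedShift N.height_le_add
  have hnonneg : ∀ a, 0 ≤ v a := fun a => by
    by_cases ha : N.IsCyclicVertex a
    · exact (hvpos a ha).le
    · exact (hv0 a ha).ge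
  -- Row `x` of the weighting at `t = 1`, with the trivial path at `x` split off.
  have hrow : ∀ x : ℤ, ∑ i ∈ Finset.Ico (f (x + 1)) x, v i + v x = 1 := by
    intro x
    have h1 := HasValueAtOne.sum (Finset.Ico (f (x + 1)) (x + 1)) fun i _ =>
      (HasValueAtOne.X_pow (pathWeight D (i : ZMod n) (x - i).toNat)).mul (hv i)
    rw [N.isWeighting_row hα hf x] at h1
    have h2 := h1.unique HasValueAtOne.one
    rw [← Int.sum_Ico_consecutive _ (N.galoisConnection_le_self hf x) (by omega : x ≤ x + 1),
      show Finset.Ico x (x + 1) = {x} by ext; simp; omega, Finset.sum_singleton] at h2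
    simpa using h2
  refine ⟨v, hv, ?_, ?_, ?_, hv0, ?_⟩
  · rintro a ⟨m, hm, h⟩
    obtain ⟨x, rfl⟩ := ZMod.intCast_surjective a
    obtain ⟨r, hr⟩ := hm.add_one
    have h1 := N.cosyzygy_empty_of_simpleInjDim_eq hf h
    rw [hr, ← two_mul, cosyzygyStep_iterate_two_mul] at h1
    exact hv0 _ (not_periodic_of_even_step N.gamma_eq hf h1)
  · rintro a ⟨m, ⟨r, rfl⟩, h⟩
    obtain ⟨x, rfl⟩ := ZMod.intCast_surjective a
    have h1 := N.cosyzygy_empty_of_simpleInjDim_eq hf h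
    rw [← two_mul, cosyzygyStep_iterate_two_mul_add_one] at h1
    rw [← hrow x, Finset.sum_eq_zero, zero_add]
    intro j hj
    rw [Finset.mem_Ico] at hj
    exact hv0 _ (not_periodic_of_odd_step N.gamma_eq hf h1 hj.1 hj.2)
  · intro a h
    obtain ⟨x, rfl⟩ := ZMod.intCast_surjective a
    -- Nonemptiness at steps `2n` and `2n + 1` is enough, since the image of `γ^n` already consists
    -- of cyclic vertices.
    have h0 := N.cosyzygy_nonempty_of_simpleInjDim_eq_top hf h (2 * n)
    have h1 := N.cosyzygy_nonempty_of_simpleInjDim_eq_top hf h (2 * n + 1)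
    rw [cosyzygyStep_iterate_two_mul] at h0
    rw [cosyzygyStep_iterate_two_mul_add_one] at h1
    refine ⟨hvpos _ (periodic_of_even_step N.gamma_eq hf h0), ?_⟩
    obtain ⟨j, hj1, hj2, hj⟩ := exists_periodic_of_odd_step N.gamma_eq hf h1
    have h2 : 0 < ∑ i ∈ Finset.Ico (f (x + 1)) x, v i :=
      Finset.sum_pos' (fun i _ => hnonneg _) ⟨j, Finset.mem_Ico.2 ⟨hj1, hj2⟩, hvpos _ hj⟩
    have := hrow x
    linarith
  · rintro a b ⟨⟨p, hp, ha⟩, m, rfl⟩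
    induction m with
    | zero => rfl
    | succ m ih =>
      rw [Function.iterate_succ_apply', hvγ, ih]
      refine ⟨p, hp, ?_⟩
      rw [← Function.iterate_add_apply, add_comm, Function.iterate_add_apply, ha]
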